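/- Let $p$ be a prime, let $L^2(\mathbb{Q}_p)$ be taken with respect to the Haar measure with $\mathrm{vol}(\mathbb{Z}_p)=1$, let $\chi(x)=e^{2\pi i\{x\}}$, where $\{x\}$ is the fractional part of $x\in\mathbb{Q}_p$, and let $\Omega$ be the characteristic function of $[0,1]$. For $k\in\mathbb{Z}$ the elements of $\mathbb{Q}_p/p^k\mathbb{Z}_p$ are represented by the finite sums $\sum_{l=-\delta}^{k-1}n_lp^l$ with $n_l\in\{0,\dots,p-1\}$. The $p$-adic wavelets are $$\psi_{\gamma nj}(x)=p^{-\gamma/2}\,\chi\big(p^{-1}j(p^{\gamma}x-n)\big)\,\Omega(|p^{\gamma}x-n|_p),\qquad \gamma\in\mathbb{Z},\ n\in\mathbb{Q}_p/\mathbb{Z}_p,\ j=1,\dots,p-1,$$ and the affine group acts by $G(a,b)f(x)=|a|_p^{-1/2}f\big(\tfrac{x-b}{a}\big)$, $a,b\in\mathbb{Q}_p$, $a\neq0$. Let $f\in D_0(\mathbb{Q}_p)$ (locally constant, compactly supported, mean zero) be nonzero, with finite wavelet expansion $f=\sum_{\gamma,n,j}C_{\gamma nj}\psi_{\gamma nj}$,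 $C_{\gamma nj}\in\mathbb{C}$. Let $\gamma_0$ be the minimal $\gamma$ among the wavelets with nonzero coefficient, and define $\gamma_A$ by $$p^{-\gamma_A}=\min\left[p^{-1},\ \frac{\max(p^{\gamma_i-1},p^{\gamma_k-1})}{|p^{-\gamma_i}n_i-p^{-\gamma_k}n_k|_p}\right],$$ the minimum being taken over all pairs $(\gamma_i,n_i)$, $(\gamma_k,n_k)$ occurring in the expansion with nonzero coefficients for which $p^{-\gamma_i}n_i-p^{-\gamma_k}n_k\neq0$. For $\gamma\in\mathbb{Z}$, $n\in\mathbb{Q}_p/p^{1-\gamma_0}\mathbb{Z}_p$ and $J=j+j_1p+\dots+j_{\gamma_A-1}p^{\gamma_A-1}$ with $j\in\{1,\dots,p-1\}$, $j_i\in\{0,\dots,p-1\}$, put $f^{(\gamma nJ)}=G(p^{\gamma}J,p^{\gamma}Jn)f$. Then the series $S=\sum_{\gamma,n,J}|f^{(\gamma nJ)}\rangle\langle f^{(\gamma nJ)}|$ converges weakly (that is, in the sense of matrix elements $\langle g,\cdot\,h\rangle$, $g,h\in L^2(\mathbb{Q}_p)$, in particular of the matrix elements in the wavelet basis), and $S$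 is the operator of multiplication by a number: $$S=\sum_{\gamma,n,J}|f^{(\gamma nJ)}\rangle\langle f^{(\gamma nJ)}|=\Big(\sum_{\gamma_1,n_1,j_1}|C_{\gamma_1n_1j_1}|^2\,p^{\gamma_A-\gamma_0+\gamma_1}\Big)\cdot\mathrm{Id}.$$ -/

import Mathlib

open MeasureTheory Metric

noncomputable section

namespace PadicFrame

/-- The field `ℚ_p` carries its Borel σ-algebra. -/
instance instMeasurableSpacePadic (p : ℕ) [Fact p.Prime] : MeasurableSpace ℚ_[p] := borel ℚ_[p]

instance instBorelSpacePadic (p : ℕ) [Fact p.Prime] : BorelSpace ℚ_[p] := ⟨rfl⟩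

/-- The Haar measure on `ℚ_p`, normalized so that the unit ball `ℤ_p` has volume one. -/
def haar (p : ℕ) [Fact p.Prime] : Measure ℚ_[p] :=
  Measure.addHaarMeasure
    ⟨⟨closedBall (0 : ℚ_[p]) 1, isCompact_closedBall _ _⟩,
      ⟨0, ball_subset_interior_closedBall (mem_ball_self one_pos)⟩⟩

instance instIsAddHaarMeasure (p : ℕ) [Fact p.Prime] : (haar p).IsAddHaarMeasure := by
  unfold haar; infer_instance

/-- The complex Hilbert space `L²(ℚ_p)`. -/
abbrev L2 (p : ℕ) [Fact p.Prime] : Type := Lp ℂ 2 (haar p)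

/-- The standard representatives of the elements of `ℚ_p / p^k ℤ_p`: the finite digit sums
`∑_{l=k-N}^{k-1} n_l p^l` with digits `0 ≤ n_l < p`. Writing `m` for the natural number
`∑_{i<N} n_{k-N+i} p^i`, which runs over all `m < p^N`, these are the numbers `m p^(k-N)`. -/
def digitReps (p : ℕ) [Fact p.Prime] (k : ℤ) : Set ℚ_[p] :=
  {x | ∃ N m : ℕ, m < p ^ N ∧ x = (m : ℚ_[p]) * (p : ℚ_[p]) ^ (k - (N : ℤ))}

theorem exists_fractionalPart (p : ℕ) [Fact p.Prime] (x : ℚ_[p]) :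
    ∃ q : ℚ, (∃ N m : ℕ, m < p ^ N ∧ q = (m : ℚ) / (p : ℚ) ^ N) ∧ ‖x - (q : ℚ_[p])‖ ≤ 1 := by
  have hp : (1 : ℝ) < p := by exact_mod_cast (Fact.out : p.Prime).one_lt
  have hp0 : (p : ℚ_[p]) ≠ 0 := by exact_mod_cast (Fact.out : p.Prime).ne_zero
  obtain ⟨N, hN⟩ := pow_unbounded_of_one_lt ‖x‖ hp
  have hnorm : ‖(p : ℚ_[p]) ^ N‖ = ((p : ℝ) ^ N)⁻¹ := by
    rw [norm_pow, Padic.norm_p, inv_pow]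
  have hpos : (0 : ℝ) < (p : ℝ) ^ N := by positivity
  have hy : ‖x * (p : ℚ_[p]) ^ N‖ ≤ 1 := by
    rw [norm_mul, hnorm, ← div_eq_mul_inv, div_le_one hpos]
    exact hN.le
  let y : ℤ_[p] := ⟨x * (p : ℚ_[p]) ^ N, hy⟩
  refine ⟨(y.appr N : ℚ) / (p : ℚ) ^ N, ⟨N, y.appr N, y.appr_lt N, rfl⟩, ?_⟩
  have h1 : ‖y - (y.appr N : ℤ_[p])‖ ≤ (p : ℝ) ^ (-(N : ℤ)) :=
    ((y - y.appr N).norm_le_pow_iff_mem_span_pow N).mpr (y.appr_spec N)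
  have h2 : x - (((y.appr N : ℚ) / (p : ℚ) ^ N : ℚ) : ℚ_[p])
      = ((y - (y.appr N : ℤ_[p]) : ℤ_[p]) : ℚ_[p]) / (p : ℚ_[p]) ^ N := by
    push_cast
    change _ = (x * (p : ℚ_[p]) ^ N - _) / _
    field_simp
  rw [h2, norm_div, hnorm, div_inv_eq_mul]
  rw [PadicInt.norm_def, zpow_neg, zpow_natCast] at h1
  calc _ ≤ ((p : ℝ) ^ N)⁻¹ * (p : ℝ) ^ N := mul_le_mul_of_nonneg_right h1 hpos.le
    _ = 1 := inv_mul_cancel₀ hpos.ne'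

/-- The fractional part `{x} = ∑_{l<0} x_l p^l` of `x = ∑_l x_l p^l`, as a rational number: the
(unique) number of the form `m / p^N`, `0 ≤ m < p^N`, with `x - {x} ∈ ℤ_p`. -/
def fractionalPart (p : ℕ) [Fact p.Prime] (x : ℚ_[p]) : ℚ :=
  Classical.choose (exists_fractionalPart p x)

/-- The additive character `χ(x) = exp(2πi{x})` of `ℚ_p`. -/
def χ (p : ℕ) [Fact p.Prime] (x : ℚ_[p]) : ℂ :=
  Complex.exp (2 * Real.pi * Complex.I * ((fractionalPart p x : ℚ) : ℂ))

/-- `Ω`, the characteristic function of the interval `[0,1]`. -/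
def Ω (t : ℝ) : ℂ := Set.indicator (Set.Icc (0 : ℝ) 1) (fun _ => (1 : ℂ)) t

/-- The indices `(γ, n, j)` of the wavelet basis: `γ ∈ ℤ`, `n ∈ ℚ_p/ℤ_p`
(standard representatives), `j = 1, …, p-1`. -/
@[ext]
structure WaveletIndex (p : ℕ) [Fact p.Prime] where
  γ : ℤ
  n : ℚ_[p]
  j : ℕ
  n_mem : n ∈ digitReps p 0
  j_pos : 1 ≤ j
  j_lt : j < p

/-- The wavelet `ψ_{γnj}(x) = p^{-γ/2} χ(p^{-1} j (p^γ x - n)) Ω(|p^γ x - n|_p)`. -/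
def wavelet (p : ℕ) [Fact p.Prime] (i : WaveletIndex p) (x : ℚ_[p]) : ℂ :=
  (((p : ℝ) ^ (-(i.γ : ℝ) / 2) : ℝ) : ℂ)
    * χ p ((p : ℚ_[p])⁻¹ * (i.j : ℚ_[p]) * ((p : ℚ_[p]) ^ i.γ * x - i.n))
    * Ω ‖(p : ℚ_[p]) ^ i.γ * x - i.n‖

/-- Membership in `D_0(ℚ_p)`: locally constant, compactly supported, mean zero. -/
structure IsD0 (p : ℕ) [Fact p.Prime] (f : ℚ_[p] → ℂ) : Prop where
  locConst : IsLocallyConstant f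
  compactSupport : HasCompactSupport f
  meanZero : ∫ x, f x ∂(haar p) = 0

/-- The action `G(a,b) f(x) = |a|_p^{-1/2} f((x-b)/a)` of the affine group (used for `a ≠ 0`). -/
def affineAct (p : ℕ) [Fact p.Prime] (a b : ℚ_[p]) (f : ℚ_[p] → ℂ) (x : ℚ_[p]) : ℂ :=
  ((‖a‖ ^ (-(1 : ℝ) / 2) : ℝ) : ℂ) * f ((x - b) / a)

theorem memLp_affineAct (p : ℕ) [Fact p.Prime] (a b : ℚ_[p]) {f : ℚ_[p] → ℂ} (hf : IsD0 p f) :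
    MemLp (affineAct p a b f) 2 (haar p) := by
  rcases eq_or_ne a 0 with rfl | ha
  · have h0 : affineAct p 0 b f = 0 := by
      funext x
      simp only [affineAct, norm_zero, Pi.zero_apply]
      rw [Real.zero_rpow (by norm_num)]
      simp
    rw [h0]
    exact MemLp.zero
  · have hc : HasCompactSupport fun x : ℚ_[p] => f ((x - b) / a) := by
      have := hf.compactSupport.comp_homeomorph
        ((Homeomorph.subRight b).trans (Homeomorph.mulRight₀ a⁻¹ (inv_ne_zero ha)))
      simpa [Function.comp_def, div_eq_mul_inv] using this
    have hcont : Continuous fun x : ℚ_[p] => f ((x - b) / a) :=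
      hf.locConst.continuous.comp (by fun_prop)
    exact (hcont.memLp_of_hasCompactSupport hc).const_mul _

/-- `G(a,b) f` as a vector of `L²(ℚ_p)`. -/
def affineVec (p : ℕ) [Fact p.Prime] (a b : ℚ_[p]) {f : ℚ_[p] → ℂ} (hf : IsD0 p f) : L2 p :=
  (memLp_affineAct p a b hf).toLp

/-- `γ₀`, the minimal `γ` among the wavelets `ψ_{γnj}` that occur in the (nonzero, finite)
expansion with coefficients `C`. -/
def gammaMin {p : ℕ} [Fact p.Prime] (C : WaveletIndex p →₀ ℂ) (hC : C ≠ 0) : ℤ :=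
  (C.support.image WaveletIndex.γ).min' ((Finsupp.support_nonempty_iff.mpr hC).image _)

/-- The center `p^{-γ} n` of the support of `ψ_{γnj}`. -/
def center {p : ℕ} [Fact p.Prime] (i : WaveletIndex p) : ℚ_[p] := (p : ℚ_[p]) ^ (-i.γ) * i.n

/-- The set of numbers whose minimum is `p^{-γ_A}`: the number `p^{-1}`, and the ratios
`max(p^{γ_i-1}, p^{γ_k-1}) / |p^{-γ_i} n_i - p^{-γ_k} n_k|_p` over all pairs of wavelets in the
expansion for which the denominator does not vanish. -/
def stabRadii {p : ℕ} [Fact p.Prime] (C : WaveletIndex p →₀ ℂ) : Set ℝ :=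
  {(p : ℝ)⁻¹} ∪ {r | ∃ i ∈ C.support, ∃ k ∈ C.support, center i - center k ≠ 0 ∧
    r = max ((p : ℝ) ^ (i.γ - 1)) ((p : ℝ) ^ (k.γ - 1)) / ‖center i - center k‖}

theorem exists_gammaA {p : ℕ} [Fact p.Prime] (C : WaveletIndex p →₀ ℂ) :
    ∃ k : ℕ, IsLeast (stabRadii C) ((p : ℝ) ^ (-(k : ℤ))) := by
  have hp : (1 : ℝ) < p := by exact_mod_cast (Fact.out : p.Prime).one_lt
  have hfin : (stabRadii C).Finite := by
    refine (Set.finite_singleton _).union ?_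
    refine ((C.support.product C.support).finite_toSet.image (fun q : WaveletIndex p ×
      WaveletIndex p => max ((p : ℝ) ^ (q.1.γ - 1)) ((p : ℝ) ^ (q.2.γ - 1))
        / ‖center q.1 - center q.2‖)).subset ?_
    rintro r ⟨i, hi, k, hk, -, rfl⟩
    exact ⟨(i, k), Finset.mem_coe.mpr (Finset.mem_product.mpr ⟨hi, hk⟩), rfl⟩
  have hmem : (p : ℝ)⁻¹ ∈ stabRadii C := Or.inl rfl
  have hpow : ∀ r ∈ stabRadii C, ∃ z : ℤ, r = (p : ℝ) ^ z := by
    rintro r (rfl | ⟨i, -, k, -, hne, rfl⟩)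
    · exact ⟨-1, by simp⟩
    · rw [Padic.norm_eq_zpow_neg_valuation hne]
      rcases max_choice ((p : ℝ) ^ (i.γ - 1)) ((p : ℝ) ^ (k.γ - 1)) with h | h <;> rw [h]
      · exact ⟨_, (zpow_sub₀ (by positivity) _ _).symm⟩
      · exact ⟨_, (zpow_sub₀ (by positivity) _ _).symm⟩
  obtain ⟨r, hr, hmin⟩ := Set.exists_min_image _ id hfin ⟨_, hmem⟩
  obtain ⟨z, rfl⟩ := hpow r hr
  have hz : z ≤ -1 := by
    have h := hmin _ hmem
    simp only [id] at h
    rw [← zpow_neg_one] at h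
    exact (zpow_le_zpow_iff_right₀ hp).mp h
  refine ⟨(-z).toNat, ?_⟩
  have hz' : -(((-z).toNat : ℕ) : ℤ) = z := by omega
  rw [hz']
  exact ⟨hr, fun s hs => hmin s hs⟩

/-- The number `γ_A`, determined by the condition that `p^{-γ_A}` is the least element
of `stabRadii C`. -/
def gammaA {p : ℕ} [Fact p.Prime] (C : WaveletIndex p →₀ ℂ) : ℕ :=
  Classical.choose (exists_gammaA C)

/-- The parameters `(γ, n, J)` of the orbit: `γ ∈ ℤ`, `n ∈ ℚ_p / p^{1-γ₀} ℤ_p` (standard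
representatives), and `J = j + j_1 p + ⋯ + j_{γ_A-1} p^{γ_A-1}` with `j = 1, …, p-1` and
`j_i = 0, …, p-1`, i.e. a natural number `J < p^{γ_A}` that is not divisible by `p`. -/
@[ext]
structure OrbitIndex (p : ℕ) [Fact p.Prime] (γ₀ : ℤ) (γA : ℕ) where
  γ : ℤ
  n : ℚ_[p]
  J : ℕ
  n_mem : n ∈ digitReps p (1 - γ₀)
  J_lt : J < p ^ γA
  not_dvd : ¬ p ∣ J

/-- The vector `f^{(γnJ)} = G(p^γ J, p^γ J n) f` of `L²(ℚ_p)`. -/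
def orbitVec {p : ℕ} [Fact p.Prime] {f : ℚ_[p] → ℂ} (hf : IsD0 p f) {γ₀ : ℤ} {γA : ℕ}
    (t : OrbitIndex p γ₀ γA) : L2 p :=
  affineVec p ((p : ℚ_[p]) ^ t.γ * (t.J : ℚ_[p])) ((p : ℚ_[p]) ^ t.γ * (t.J : ℚ_[p]) * t.n) hf

end PadicFrame

end

noncomputable section

namespace PadicFrame

/-! For a p-adic unit J, the operator G(p^γ J, p^γ J n) sends a wavelet to a wave of scale γ_i - γ,
center p^γ J (n + c_i) and frequency j_i / J, where c_i = p^(-γ_i) n_i. Up to a phase, such a wave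
depends only on the ball containing its center and on its frequency modulo p, so it is again a basis
wavelet (`waveVec_congr`). Expanding f in both slots of each rank-one operator splits S into
diagonal terms and mixed terms.

Diagonal terms: the orbit of ψ_i meets every wavelet equally often. The last digit of J is forced by
the target frequency, while its other γ_A - 1 digits are free. The translation n is fixed up to a
ball of radius p^(γ_i), which contains p^(γ_i + 1 - γ₀) classes modulo p^(1-γ₀) ℤ_p. The
multiplicity is thus p^(γ_A - γ₀ + γ_i), and Parseval's identity gives that multiple of the identity
(`orbitParam_bijective`, `hasSum_orbitWave`).

Mixed terms: for i ≠ k some permutation of the parameters multiplies the two orbits by different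
constant phases (`exists_orbitPerm_phase`). The absolutely convergent mixed sum then equals itself
times a number other than 1, so it vanishes. If the scales or frequencies differ, a translation n ↦
n + e works. Otherwise J ↦ J(1 + p^s) is used, with n adjusted to fix the image of ψ_i and p^s =
|c_i - c_k| / p^(γ_i); the definition of γ_A guarantees s < γ_A, so this step is visible modulo
p^(γ_A). -/

/-! ### Fractional parts and the additive character -/

theorem exists_int_of_norm_le_one {p : ℕ} [Fact p.Prime] {q : ℚ} {M : ℕ} {z : ℤ}
    (hz : q * (p : ℚ) ^ M = z) (hq : ‖(q : ℚ_[p])‖ ≤ 1) : ∃ w : ℤ, q = w := by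
  have hp0 : (p : ℚ) ≠ 0 := by exact_mod_cast (Fact.out : p.Prime).ne_zero
  have h1 : ‖(z : ℚ_[p])‖ ≤ (p : ℝ) ^ (-(M : ℤ)) := by
    have : (z : ℚ_[p]) = (q : ℚ_[p]) * (p : ℚ_[p]) ^ M := by exact_mod_cast hz.symm
    rw [this, norm_mul, norm_pow, Padic.norm_p, zpow_neg, zpow_natCast, inv_pow]
    exact mul_le_of_le_one_left (by positivity) hq
  obtain ⟨w, hw⟩ := (Padic.norm_int_le_pow_iff_dvd z M).mp h1
  refine ⟨w, mul_right_cancel₀ (pow_ne_zero M hp0) ?_⟩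
  rw [hz, hw]
  push_cast
  ring

theorem fractionalPart_spec (p : ℕ) [Fact p.Prime] (x : ℚ_[p]) :
    (∃ N m : ℕ, m < p ^ N ∧ fractionalPart p x = (m : ℚ) / (p : ℚ) ^ N) ∧
      ‖x - (fractionalPart p x : ℚ_[p])‖ ≤ 1 :=
  Classical.choose_spec (exists_fractionalPart p x)

theorem exists_fractionalPart_mul_pow (p : ℕ) [Fact p.Prime] (x : ℚ_[p]) :
    ∃ N : ℕ, ∃ z : ℤ, fractionalPart p x * (p : ℚ) ^ N = z := by
  have hp0 : (p : ℚ) ≠ 0 := by exact_mod_cast (Fact.out : p.Prime).ne_zero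
  obtain ⟨⟨N, m, -, h⟩, -⟩ := fractionalPart_spec p x
  refine ⟨N, m, ?_⟩
  rw [h, div_mul_cancel₀ _ (pow_ne_zero N hp0)]
  simp

theorem norm_le_of_norm_sub_le {p : ℕ} [Fact p.Prime] {x y : ℚ_[p]} {r : ℝ} (h : ‖x - y‖ ≤ r)
    (hy : ‖y‖ ≤ r) : ‖x‖ ≤ r := by
  have := Padic.nonarchimedean (x - y) y
  rw [sub_add_cancel] at this
  exact this.trans (max_le h hy)

theorem norm_sub_le_of_le {p : ℕ} [Fact p.Prime] {x y : ℚ_[p]} {r : ℝ} (hx : ‖x‖ ≤ r)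
    (hy : ‖y‖ ≤ r) : ‖x - y‖ ≤ r := by
  rw [sub_eq_add_neg]
  exact (Padic.nonarchimedean x (-y)).trans (max_le hx (by rwa [norm_neg]))

theorem norm_add_le_of_le {p : ℕ} [Fact p.Prime] {x y : ℚ_[p]} {r : ℝ} (hx : ‖x‖ ≤ r)
    (hy : ‖y‖ ≤ r) : ‖x + y‖ ≤ r :=
  (Padic.nonarchimedean x y).trans (max_le hx hy)

theorem χ_add (p : ℕ) [Fact p.Prime] (x y : ℚ_[p]) : χ p (x + y) = χ p x * χ p y := by
  obtain ⟨N, z, hz⟩ := exists_fractionalPart_mul_pow p x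
  obtain ⟨N', z', hz'⟩ := exists_fractionalPart_mul_pow p y
  obtain ⟨N'', z'', hz''⟩ := exists_fractionalPart_mul_pow p (x + y)
  -- The defect of additivity has a power of p as denominator and lies in ℤ_p, hence is an integer,
  -- which the exponential does not see.
  have key : ∃ w : ℤ, fractionalPart p (x + y) - fractionalPart p x - fractionalPart p y = w := by
    refine exists_int_of_norm_le_one (p := p) (M := N + N' + N'')
      (z := z'' * p ^ (N + N') - z * p ^ (N' + N'') - z' * p ^ (N + N'')) ?_ ?_
    · push_cast
      rw [← hz, ← hz', ← hz'']
      ring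
    · have hx := (fractionalPart_spec p x).2
      have hy := (fractionalPart_spec p y).2
      have hxy := (fractionalPart_spec p (x + y)).2
      have : ((fractionalPart p (x + y) - fractionalPart p x - fractionalPart p y : ℚ) : ℚ_[p])
          = ((x - fractionalPart p x) + (y - fractionalPart p y))
            - (x + y - fractionalPart p (x + y)) := by
        push_cast
        ring
      rw [this]
      exact norm_sub_le_of_le (norm_add_le_of_le hx hy) hxy
  obtain ⟨w, hw⟩ := key
  have hw' : fractionalPart p (x + y) = fractionalPart p x + fractionalPart p y + w := by
    rw [← hw]
    ring
  unfold χ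
  rw [hw', ← Complex.exp_add]
  refine Complex.exp_eq_exp_iff_exists_int.mpr ⟨w, ?_⟩
  push_cast
  ring

theorem χ_eq_one_iff (p : ℕ) [Fact p.Prime] (x : ℚ_[p]) : χ p x = 1 ↔ ‖x‖ ≤ 1 := by
  obtain ⟨N, z, hz⟩ := exists_fractionalPart_mul_pow p x
  have hx := (fractionalPart_spec p x).2
  have hI : (2 * Real.pi * Complex.I : ℂ) ≠ 0 := Complex.two_pi_I_ne_zero
  unfold χ
  rw [Complex.exp_eq_one_iff]
  constructor
  · rintro ⟨n, hn⟩
    rw [mul_comm] at hn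
    have h1 : ((fractionalPart p x : ℚ) : ℂ) = n := mul_right_cancel₀ hI hn
    have h2 : fractionalPart p x = n := by exact_mod_cast h1
    rw [h2] at hx
    refine norm_le_of_norm_sub_le hx ?_
    rw [Rat.cast_intCast]
    exact Padic.norm_int_le_one n
  · intro h
    rw [norm_sub_rev] at hx
    obtain ⟨w, hw⟩ := exists_int_of_norm_le_one hz (norm_le_of_norm_sub_le hx h)
    refine ⟨w, ?_⟩
    rw [hw]
    push_cast
    ring

theorem χ_zero (p : ℕ) [Fact p.Prime] : χ p 0 = 1 := by
  rw [χ_eq_one_iff]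
  simp

theorem norm_χ (p : ℕ) [Fact p.Prime] (x : ℚ_[p]) : ‖χ p x‖ = 1 := by
  have : (2 * Real.pi * Complex.I * ((fractionalPart p x : ℚ) : ℂ))
      = ((2 * Real.pi * (fractionalPart p x : ℝ) : ℝ) : ℂ) * Complex.I := by
    push_cast
    ring
  rw [χ, this, Complex.norm_exp_ofReal_mul_I]

theorem χ_ne_zero (p : ℕ) [Fact p.Prime] (x : ℚ_[p]) : χ p x ≠ 0 := by
  rw [← norm_ne_zero_iff, norm_χ]
  exact one_ne_zero

theorem χ_neg (p : ℕ) [Fact p.Prime] (x : ℚ_[p]) : χ p (-x) = starRingEnd ℂ (χ p x) := by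
  have h := χ_add p x (-x)
  rw [add_neg_cancel, χ_zero] at h
  have h2 : χ p x * starRingEnd ℂ (χ p x) = 1 := by
    rw [Complex.mul_conj, Complex.normSq_eq_norm_sq, norm_χ]
    norm_num
  exact mul_left_cancel₀ (χ_ne_zero p x) (h.symm.trans h2.symm)

theorem χ_add_of_norm_le_one (p : ℕ) [Fact p.Prime] {x y : ℚ_[p]} (hy : ‖y‖ ≤ 1) :
    χ p (x + y) = χ p x := by
  rw [χ_add, (χ_eq_one_iff p y).mpr hy, mul_one]

theorem χ_eq_of_norm_sub_le_one (p : ℕ) [Fact p.Prime] {x y : ℚ_[p]} (h : ‖x - y‖ ≤ 1) :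
    χ p x = χ p y := by
  rw [← χ_add_of_norm_le_one p (x := y) h, add_sub_cancel]

theorem χ_nsmul (p : ℕ) [Fact p.Prime] (x : ℚ_[p]) (n : ℕ) : χ p (n * x) = χ p x ^ n := by
  induction n with
  | zero => simp [χ_zero]
  | succ n ih =>
    rw [pow_succ, ← ih, ← χ_add]
    congr 1
    push_cast
    ring

/-! ### Balls and standard representatives -/

theorem norm_prime_zpow {p : ℕ} [Fact p.Prime] (z : ℤ) :
    ‖(p : ℚ_[p]) ^ z‖ = (p : ℝ) ^ (-z) := Padic.norm_p_zpow z

theorem one_lt_prime (p : ℕ) [Fact p.Prime] : (1 : ℝ) < p := by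
  exact_mod_cast (Fact.out : p.Prime).one_lt

theorem prime_ne_zero (p : ℕ) [Fact p.Prime] : (p : ℚ_[p]) ≠ 0 := by
  exact_mod_cast (Fact.out : p.Prime).ne_zero

theorem prime_pos (p : ℕ) [Fact p.Prime] : (0 : ℝ) < p := zero_lt_one.trans (one_lt_prime p)

/-- The elements of a ball, up to elements of a smaller concentric ball. -/
theorem exists_nat_norm_sub_le {p : ℕ} [Fact p.Prime] {x : ℚ_[p]} {r : ℤ}
    (hx : ‖x‖ ≤ (p : ℝ) ^ r) (N : ℕ) :
    ∃ m < p ^ N, ‖x - m * (p : ℚ_[p]) ^ (-r)‖ ≤ (p : ℝ) ^ (r - N) := by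
  have hp := prime_pos p
  have hp0 := prime_ne_zero p
  have hy : ‖x * (p : ℚ_[p]) ^ r‖ ≤ 1 := by
    rw [norm_mul, norm_prime_zpow, zpow_neg, ← div_eq_mul_inv, div_le_one (by positivity)]
    exact hx
  let y : ℤ_[p] := ⟨x * (p : ℚ_[p]) ^ r, hy⟩
  refine ⟨y.appr N, y.appr_lt N, ?_⟩
  have h1 : ‖y - (y.appr N : ℤ_[p])‖ ≤ (p : ℝ) ^ (-(N : ℤ)) :=
    ((y - y.appr N).norm_le_pow_iff_mem_span_pow N).mpr (y.appr_spec N)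
  have h2 : x - y.appr N * (p : ℚ_[p]) ^ (-r)
      = ((y - (y.appr N : ℤ_[p]) : ℤ_[p]) : ℚ_[p]) * (p : ℚ_[p]) ^ (-r) := by
    change _ = (x * (p : ℚ_[p]) ^ r - ((y.appr N : ℤ_[p]) : ℚ_[p])) * _
    rw [sub_mul, mul_assoc, ← zpow_add₀ hp0, add_neg_cancel, zpow_zero, mul_one,
      PadicInt.coe_natCast]
  rw [h2, norm_mul, norm_prime_zpow, neg_neg, show r - (N : ℤ) = -N + r by ring, zpow_add₀ hp.ne']
  exact mul_le_mul_of_nonneg_right h1 (by positivity)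

theorem nat_eq_of_norm_sub_le {p : ℕ} [Fact p.Prime] {m m' N : ℕ} (hm : m < p ^ N)
    (hm' : m' < p ^ N) (h : ‖(m : ℚ_[p]) - m'‖ ≤ (p : ℝ) ^ (-(N : ℤ))) : m = m' := by
  have h1 : ‖(((m : ℤ) - m' : ℤ) : ℚ_[p])‖ ≤ (p : ℝ) ^ (-(N : ℤ)) := by
    push_cast
    exact h
  have h2 := (Padic.norm_int_le_pow_iff_dvd _ N).mp h1
  have h3 : (m' : ℤ) ≡ m [ZMOD (p ^ N : ℕ)] := Int.modEq_iff_dvd.mpr (by exact_mod_cast h2)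
  exact ((Int.natCast_modEq_iff.mp h3).eq_of_lt_of_lt hm' hm).symm

theorem exists_digitRep (p : ℕ) [Fact p.Prime] (k : ℤ) (x : ℚ_[p]) :
    ∃ n ∈ digitReps p k, ‖x - n‖ ≤ (p : ℝ) ^ (-k) := by
  have hp := prime_pos p
  obtain ⟨N, hN⟩ := pow_unbounded_of_one_lt (‖x‖ * (p : ℝ) ^ k) (one_lt_prime p)
  have hx : ‖x‖ ≤ (p : ℝ) ^ ((N : ℤ) - k) := by
    rw [zpow_sub₀ hp.ne', le_div_iff₀ (by positivity), zpow_natCast]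
    exact hN.le
  obtain ⟨m, hm, h⟩ := exists_nat_norm_sub_le hx N
  refine ⟨_, ⟨N, m, hm, rfl⟩, ?_⟩
  rw [neg_sub, sub_sub_cancel_left] at h
  exact h

/-- The standard representative of a class of `ℚ_p / p^k ℤ_p`. -/
def digitRep (p : ℕ) [Fact p.Prime] (k : ℤ) (x : ℚ_[p]) : ℚ_[p] :=
  Classical.choose (exists_digitRep p k x)

theorem digitRep_mem (p : ℕ) [Fact p.Prime] (k : ℤ) (x : ℚ_[p]) :
    digitRep p k x ∈ digitReps p k :=
  (Classical.choose_spec (exists_digitRep p k x)).1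

theorem norm_sub_digitRep (p : ℕ) [Fact p.Prime] (k : ℤ) (x : ℚ_[p]) :
    ‖x - digitRep p k x‖ ≤ (p : ℝ) ^ (-k) :=
  (Classical.choose_spec (exists_digitRep p k x)).2

theorem eq_of_mem_digitReps {p : ℕ} [Fact p.Prime] {k : ℤ} {n n' : ℚ_[p]}
    (hn : n ∈ digitReps p k) (hn' : n' ∈ digitReps p k) (h : ‖n - n'‖ ≤ (p : ℝ) ^ (-k)) :
    n = n' := by
  have hp := prime_pos p
  have hp0 := prime_ne_zero p
  obtain ⟨N, m, hm, rfl⟩ := hn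
  obtain ⟨N', m', hm', rfl⟩ := hn'
  -- Padding with zero digits brings both representatives to the common denominator exponent N + N',
  -- which reduces uniqueness to naturals below p^(N+N').
  have e1 : ∀ (m N N' : ℕ), (m : ℚ_[p]) * (p : ℚ_[p]) ^ (k - (N : ℤ))
      = ((m * p ^ N' : ℕ) : ℚ_[p]) * (p : ℚ_[p]) ^ (k - (N + N' : ℕ) : ℤ) := by
    intro m N N'
    push_cast
    rw [mul_assoc, ← zpow_natCast, ← zpow_add₀ hp0]
    congr 2
    ring
  rw [e1 m N N', e1 m' N' N, add_comm N' N] at h ⊢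
  congr 2
  refine nat_eq_of_norm_sub_le (p := p) (N := N + N') ?_ ?_ ?_
  · rw [pow_add]
    exact Nat.mul_lt_mul_of_pos_right hm (pow_pos (Fact.out : p.Prime).pos _)
  · rw [pow_add, mul_comm]
    exact Nat.mul_lt_mul_of_pos_left hm' (pow_pos (Fact.out : p.Prime).pos _)
  · rw [← sub_mul, norm_mul, norm_prime_zpow, ← le_div_iff₀ (by positivity),
      ← zpow_sub₀ hp.ne'] at h
    rwa [show -k - -(k - ((N + N' : ℕ) : ℤ)) = -((N + N' : ℕ) : ℤ) by ring] at h

theorem digitRep_eq {p : ℕ} [Fact p.Prime] {k : ℤ} {n x : ℚ_[p]}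
    (hn : n ∈ digitReps p k) (h : ‖x - n‖ ≤ (p : ℝ) ^ (-k)) : digitRep p k x = n := by
  refine eq_of_mem_digitReps (digitRep_mem p k x) hn ?_
  have := norm_sub_le_of_le h (norm_sub_digitRep p k x)
  rwa [sub_sub_sub_cancel_left] at this

/-! ### Waves with arbitrary center and frequency -/

/-- The function `p^{-γ/2} χ(p^{-1} j p^γ (x - c)) Ω(|p^γ (x - c)|_p)` with arbitrary center `c` and
frequency `j`. -/
def waveFun (p : ℕ) [Fact p.Prime] (γ : ℤ) (c j x : ℚ_[p]) : ℂ :=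
  (((p : ℝ) ^ (-(γ : ℝ) / 2) : ℝ) : ℂ) * χ p ((p : ℚ_[p])⁻¹ * j * ((p : ℚ_[p]) ^ γ * (x - c)))
    * Ω ‖(p : ℚ_[p]) ^ γ * (x - c)‖

theorem wavelet_eq_waveFun {p : ℕ} [Fact p.Prime] (i : WaveletIndex p) :
    wavelet p i = waveFun p i.γ (center i) i.j := by
  funext x
  have : (p : ℚ_[p]) ^ i.γ * (x - center i) = (p : ℚ_[p]) ^ i.γ * x - i.n := by
    rw [center, mul_sub, ← mul_assoc, ← zpow_add₀ (prime_ne_zero p), add_neg_cancel, zpow_zero,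
      one_mul]
  rw [wavelet, waveFun, this]

theorem Ω_norm_of_le {p : ℕ} [Fact p.Prime] {y : ℚ_[p]} (h : ‖y‖ ≤ 1) : Ω ‖y‖ = 1 :=
  Set.indicator_of_mem (Set.mem_Icc.mpr ⟨norm_nonneg _, h⟩) _

theorem Ω_norm_of_not_le {p : ℕ} [Fact p.Prime] {y : ℚ_[p]} (h : ¬ ‖y‖ ≤ 1) : Ω ‖y‖ = 0 :=
  Set.indicator_of_notMem (fun h' => h (Set.mem_Icc.mp h').2) _

theorem norm_inv_prime_mul_le_one {p : ℕ} [Fact p.Prime] {j : ℚ_[p]} (hj : ‖j‖ ≤ (p : ℝ)⁻¹) :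
    ‖(p : ℚ_[p])⁻¹ * j‖ ≤ 1 := by
  have hp := prime_pos p
  rw [norm_mul, norm_inv, Padic.norm_p, inv_inv]
  calc (p : ℝ) * ‖j‖ ≤ p * (p : ℝ)⁻¹ := mul_le_mul_of_nonneg_left hj hp.le
    _ = 1 := mul_inv_cancel₀ hp.ne'

/-- Moving the center inside the ball adds a constant to the argument of `χ`, and changing the
frequency by a multiple of p adds an element of ℤ_p on the support; the support itself does not move
because the norm is ultrametric. -/
theorem waveFun_congr {p : ℕ} [Fact p.Prime] {γ : ℤ} {c c' j j' : ℚ_[p]}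
    (hc : ‖(p : ℚ_[p]) ^ γ * (c - c')‖ ≤ 1) (hj : ‖j' - j‖ ≤ (p : ℝ)⁻¹) (x : ℚ_[p]) :
    waveFun p γ c' j' x
      = χ p ((p : ℚ_[p])⁻¹ * j * ((p : ℚ_[p]) ^ γ * (c - c'))) * waveFun p γ c j x := by
  have e : (p : ℚ_[p]) ^ γ * (x - c')
      = (p : ℚ_[p]) ^ γ * (x - c) + (p : ℚ_[p]) ^ γ * (c - c') := by ring
  by_cases h : ‖(p : ℚ_[p]) ^ γ * (x - c)‖ ≤ 1
  · have h' : ‖(p : ℚ_[p]) ^ γ * (x - c')‖ ≤ 1 := by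
      rw [e]
      exact norm_add_le_of_le h hc
    have hχ : χ p ((p : ℚ_[p])⁻¹ * j' * ((p : ℚ_[p]) ^ γ * (x - c')))
        = χ p ((p : ℚ_[p])⁻¹ * j * ((p : ℚ_[p]) ^ γ * (x - c'))) := by
      refine χ_eq_of_norm_sub_le_one p ?_
      rw [← sub_mul, ← mul_sub, norm_mul]
      exact mul_le_one₀ (norm_inv_prime_mul_le_one hj) (norm_nonneg _) h'
    rw [waveFun, waveFun, Ω_norm_of_le h, Ω_norm_of_le h', hχ, e, mul_add, χ_add]
    ring
  · have h' : ¬ ‖(p : ℚ_[p]) ^ γ * (x - c')‖ ≤ 1 := by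
      intro h'
      refine h ?_
      have := norm_sub_le_of_le h' hc
      rwa [e, add_sub_cancel_right] at this
    rw [waveFun, waveFun, Ω_norm_of_not_le h, Ω_norm_of_not_le h']
    ring

theorem waveFun_add {p : ℕ} [Fact p.Prime] {γ : ℤ} {e : ℚ_[p]} (c j x : ℚ_[p])
    (he : ‖(p : ℚ_[p]) ^ γ * e‖ ≤ 1) :
    waveFun p γ c j (x + e)
      = χ p ((p : ℚ_[p])⁻¹ * j * ((p : ℚ_[p]) ^ γ * e)) * waveFun p γ c j x := by
  have h := waveFun_congr (p := p) (γ := γ) (c := c) (c' := c - e) (j := j) (j' := j)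
    (by rwa [sub_sub_cancel]) (by simp) x
  rw [sub_sub_cancel] at h
  rw [← h, waveFun, waveFun, show x - (c - e) = x + e - c by ring]

theorem norm_zpow_mul_le_one_iff {p : ℕ} [Fact p.Prime] {γ : ℤ} {y : ℚ_[p]} :
    ‖(p : ℚ_[p]) ^ γ * y‖ ≤ 1 ↔ ‖y‖ ≤ (p : ℝ) ^ γ := by
  have hp := prime_pos p
  rw [norm_mul, norm_prime_zpow, zpow_neg, inv_mul_le_iff₀ (by positivity), mul_one]

theorem waveFun_eq_zero {p : ℕ} [Fact p.Prime] {γ : ℤ} {c j x : ℚ_[p]}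
    (h : x ∉ closedBall c ((p : ℝ) ^ γ)) : waveFun p γ c j x = 0 := by
  rw [mem_closedBall_iff_norm, ← norm_zpow_mul_le_one_iff] at h
  rw [waveFun, Ω_norm_of_not_le h, mul_zero]

theorem isLocallyConstant_waveFun (p : ℕ) [Fact p.Prime] (γ : ℤ) (c j : ℚ_[p]) :
    IsLocallyConstant (waveFun p γ c j) := by
  rw [IsLocallyConstant.iff_eventually_eq]
  intro x
  have hc : ∀ a : ℚ_[p], ∀ᶠ y in nhds x, ‖a * (y - x)‖ < 1 := by
    intro a
    have : Continuous fun y : ℚ_[p] => ‖a * (y - x)‖ := by fun_prop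
    exact this.continuousAt.eventually_lt continuousAt_const (by simp)
  filter_upwards [hc ((p : ℚ_[p]) ^ γ), hc ((p : ℚ_[p])⁻¹ * j * (p : ℚ_[p]) ^ γ)] with y h1 h2
  have := waveFun_add (p := p) (γ := γ) (e := y - x) c j x h1.le
  rw [add_sub_cancel, (χ_eq_one_iff p _).mpr, one_mul] at this
  · exact this
  · rw [← mul_assoc]
    exact h2.le

theorem memLp_waveFun (p : ℕ) [Fact p.Prime] (γ : ℤ) (c j : ℚ_[p]) :
    MemLp (waveFun p γ c j) 2 (haar p) :=
  (isLocallyConstant_waveFun p γ c j).continuous.memLp_of_hasCompactSupport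
    (HasCompactSupport.intro (isCompact_closedBall c ((p : ℝ) ^ γ)) fun _ h => waveFun_eq_zero h)

/-- `waveFun` as a vector of `L²(ℚ_p)`. -/
def waveVec (p : ℕ) [Fact p.Prime] (γ : ℤ) (c j : ℚ_[p]) : L2 p := (memLp_waveFun p γ c j).toLp

theorem waveVec_congr {p : ℕ} [Fact p.Prime] {γ : ℤ} {c c' j j' : ℚ_[p]}
    (hc : ‖(p : ℚ_[p]) ^ γ * (c - c')‖ ≤ 1) (hj : ‖j' - j‖ ≤ (p : ℝ)⁻¹) :
    waveVec p γ c' j' = χ p ((p : ℚ_[p])⁻¹ * j * ((p : ℚ_[p]) ^ γ * (c - c'))) • waveVec p γ c j := by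
  rw [waveVec, waveVec, ← MemLp.toLp_const_smul]
  congr 1
  funext x
  exact waveFun_congr hc hj x

theorem norm_rpow_half {p : ℕ} [Fact p.Prime] (v : ℤ) {J : ℚ_[p]} (hJ : ‖J‖ = 1) :
    ‖(p : ℚ_[p]) ^ v * J‖ ^ (-(1 : ℝ) / 2) = (p : ℝ) ^ ((v : ℝ) / 2) := by
  rw [norm_mul, hJ, mul_one, norm_prime_zpow, ← Real.rpow_intCast,
    ← Real.rpow_mul (prime_pos p).le]
  congr 1
  push_cast
  ring

/-- The unit J disappears from `Ω` and is absorbed by the frequency in `χ`, while the powers of p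
shift the scale. The quotient j / J is in general no natural number, which is why `waveFun` takes
p-adic frequencies. -/
theorem affineAct_waveFun {p : ℕ} [Fact p.Prime] (γ v : ℤ) {J : ℚ_[p]} (hJ : ‖J‖ = 1)
    (n c j : ℚ_[p]) :
    affineAct p ((p : ℚ_[p]) ^ v * J) ((p : ℚ_[p]) ^ v * J * n) (waveFun p γ c j)
      = waveFun p (γ - v) ((p : ℚ_[p]) ^ v * J * (n + c)) (j / J) := by
  have hp0 := prime_ne_zero p
  have hJ0 : J ≠ 0 := norm_ne_zero_iff.mp (by rw [hJ]; exact one_ne_zero)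
  have hv : (p : ℚ_[p]) ^ v ≠ 0 := zpow_ne_zero _ hp0
  funext x
  have e : (p : ℚ_[p]) ^ γ * ((x - (p : ℚ_[p]) ^ v * J * n) / ((p : ℚ_[p]) ^ v * J) - c)
      = (p : ℚ_[p]) ^ (γ - v) * (x - (p : ℚ_[p]) ^ v * J * (n + c)) / J := by
    rw [zpow_sub₀ hp0]
    field_simp
    ring
  have e2 : (p : ℝ) ^ ((v : ℝ) / 2) * (p : ℝ) ^ (-(γ : ℝ) / 2)
      = (p : ℝ) ^ (-((γ - v : ℤ) : ℝ) / 2) := by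
    rw [← Real.rpow_add (prime_pos p)]
    congr 1
    push_cast
    ring
  rw [affineAct, waveFun, waveFun, e, norm_div, hJ, div_one, norm_rpow_half v hJ, ← e2]
  push_cast
  rw [show (p : ℚ_[p])⁻¹ * (j / J) * ((p : ℚ_[p]) ^ (γ - v) * (x - (p : ℚ_[p]) ^ v * J * (n + c)))
    = (p : ℚ_[p])⁻¹ * j * ((p : ℚ_[p]) ^ (γ - v) * (x - (p : ℚ_[p]) ^ v * J * (n + c)) / J) by
    field_simp]
  ring

/-! ### Haar measure of balls and inner products of waves -/

theorem closedBall_eq_iUnion {p : ℕ} [Fact p.Prime] (c : ℚ_[p]) (γ : ℤ) :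
    closedBall c ((p : ℝ) ^ (γ + 1)) = ⋃ m ∈ Finset.range p,
      closedBall (c + (m : ℚ_[p]) * (p : ℚ_[p]) ^ (-(γ + 1))) ((p : ℝ) ^ γ) := by
  ext x
  simp only [mem_closedBall_iff_norm, Set.mem_iUnion, Finset.mem_range, exists_prop]
  constructor
  · intro h
    obtain ⟨m, hm, h1⟩ := exists_nat_norm_sub_le h 1
    refine ⟨m, by simpa using hm, ?_⟩
    rw [sub_sub] at h1
    simpa using h1
  · rintro ⟨m, -, h⟩
    rw [← sub_sub] at h
    refine norm_le_of_norm_sub_le (h.trans (zpow_le_zpow_right₀ (one_lt_prime p).le (by lia))) ?_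
    rw [norm_mul, norm_prime_zpow, neg_neg]
    have := prime_pos p
    exact mul_le_of_le_one_left (by positivity) (by simpa using Padic.norm_int_le_one (p := p) m)

theorem closedBall_disjoint {p : ℕ} [Fact p.Prime] (c : ℚ_[p]) (γ : ℤ) {m m' : ℕ} (hm : m < p)
    (hm' : m' < p) (h : m ≠ m') :
    Disjoint (closedBall (c + (m : ℚ_[p]) * (p : ℚ_[p]) ^ (-(γ + 1))) ((p : ℝ) ^ γ))
      (closedBall (c + (m' : ℚ_[p]) * (p : ℚ_[p]) ^ (-(γ + 1))) ((p : ℝ) ^ γ)) := by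
  have hp := prime_pos p
  rw [Set.disjoint_left]
  intro x hx hx'
  rw [mem_closedBall_iff_norm] at hx hx'
  refine h (nat_eq_of_norm_sub_le (p := p) (N := 1) (by simpa) (by simpa) ?_)
  have := norm_sub_le_of_le hx' hx
  rw [sub_sub_sub_cancel_left, add_sub_add_left_eq_sub, ← sub_mul, norm_mul, norm_prime_zpow,
    neg_neg, ← le_div_iff₀ (by positivity), ← zpow_sub₀ hp.ne'] at this
  simpa using this

/-- A ball is the disjoint union of p translates of the next smaller ball, so the normalization on
ℤ_p propagates to all radii in both directions. -/
theorem haar_real_closedBall (p : ℕ) [Fact p.Prime] (γ : ℤ) (c : ℚ_[p]) :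
    (haar p).real (closedBall c ((p : ℝ) ^ γ)) = (p : ℝ) ^ γ := by
  have hp := prime_pos p
  have trans : ∀ (c : ℚ_[p]) (r : ℝ),
      (haar p).real (closedBall c r) = (haar p).real (closedBall 0 r) := by
    intro c r
    have := measure_preimage_add_right (haar p) (-c) (closedBall (0 : ℚ_[p]) r)
    rw [measureReal_def, measureReal_def, ← this]
    congr 2
    ext x
    simp [sub_eq_add_neg]
  have step : ∀ γ : ℤ, (haar p).real (closedBall 0 ((p : ℝ) ^ (γ + 1)))
      = p * (haar p).real (closedBall 0 ((p : ℝ) ^ γ)) := by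
    intro γ
    have hfin : ∀ m ∈ Finset.range p, haar p (closedBall
        ((0 : ℚ_[p]) + (m : ℚ_[p]) * (p : ℚ_[p]) ^ (-(γ + 1))) ((p : ℝ) ^ γ)) ≠ ⊤ :=
      fun m _ => (isCompact_closedBall _ _).measure_lt_top.ne
    rw [closedBall_eq_iUnion, measureReal_biUnion_finset (h := hfin)]
    · simp_rw [trans (_ + _)]
      simp
    · intro m hm m' hm' h
      exact closedBall_disjoint 0 γ (by simpa using hm) (by simpa using hm') h
    · intro m _
      exact measurableSet_closedBall
  rw [trans]
  induction γ using Int.induction_on with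
  | zero =>
    rw [zpow_zero, measureReal_def]
    have : haar p (closedBall (0 : ℚ_[p]) 1) = 1 := Measure.addHaarMeasure_self
    rw [this, ENNReal.toReal_one]
  | succ n ih => rw [step, ih, zpow_add_one₀ hp.ne', mul_comm]
  | pred n ih =>
    have := step (-(n : ℤ) - 1)
    rw [sub_add_cancel, ih] at this
    refine mul_left_cancel₀ hp.ne' (this.symm.trans ?_)
    rw [← zpow_one_add₀ hp.ne']
    congr 1
    ring

theorem inner_waveVec {p : ℕ} [Fact p.Prime] (γ γ' : ℤ) (c c' j j' : ℚ_[p]) :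
    inner ℂ (waveVec p γ c j) (waveVec p γ' c' j')
      = ∫ x, starRingEnd ℂ (waveFun p γ c j x) * waveFun p γ' c' j' x ∂(haar p) := by
  rw [L2.inner_def]
  refine integral_congr_ae ?_
  filter_upwards [(memLp_waveFun p γ c j).coeFn_toLp, (memLp_waveFun p γ' c' j').coeFn_toLp]
    with x h1 h2
  rw [waveVec, waveVec, h1, h2, RCLike.inner_apply, mul_comm]

/-- Translation by e multiplies each wave by a phase, so invariance of the Haar measure makes the
inner product equal to itself times a ratio of phases different from 1. -/
theorem inner_waveVec_eq_zero_of_translation {p : ℕ} [Fact p.Prime] {γ γ' : ℤ}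
    {c c' j j' e : ℚ_[p]} (h : ‖(p : ℚ_[p]) ^ γ * e‖ ≤ 1) (h' : ‖(p : ℚ_[p]) ^ γ' * e‖ ≤ 1)
    (hne : χ p ((p : ℚ_[p])⁻¹ * j * ((p : ℚ_[p]) ^ γ * e))
      ≠ χ p ((p : ℚ_[p])⁻¹ * j' * ((p : ℚ_[p]) ^ γ' * e))) :
    inner ℂ (waveVec p γ c j) (waveVec p γ' c' j') = 0 := by
  rw [inner_waveVec]
  set ζ := χ p ((p : ℚ_[p])⁻¹ * j * ((p : ℚ_[p]) ^ γ * e)) with hζ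
  set ζ' := χ p ((p : ℚ_[p])⁻¹ * j' * ((p : ℚ_[p]) ^ γ' * e)) with hζ'
  have key := integral_add_right_eq_self (μ := haar p)
    (fun x => starRingEnd ℂ (waveFun p γ c j x) * waveFun p γ' c' j' x) e
  have e1 : ∀ x, starRingEnd ℂ (waveFun p γ c j (x + e)) * waveFun p γ' c' j' (x + e)
      = (starRingEnd ℂ ζ * ζ') * (starRingEnd ℂ (waveFun p γ c j x) * waveFun p γ' c' j' x) := by
    intro x
    rw [waveFun_add c j x h, waveFun_add c' j' x h', map_mul]
    ring
  simp_rw [e1] at key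
  rw [integral_const_mul] at key
  by_contra hI
  have h1 : starRingEnd ℂ ζ * ζ' = 1 := mul_right_cancel₀ hI (key.trans (one_mul _).symm)
  have h2 : starRingEnd ℂ ζ * ζ = 1 := by
    rw [mul_comm, Complex.mul_conj, Complex.normSq_eq_norm_sq, hζ, norm_χ]
    norm_num
  have h3 : starRingEnd ℂ ζ ≠ 0 := left_ne_zero_of_mul_eq_one h1
  exact hne (mul_left_cancel₀ h3 (h2.trans h1.symm))

theorem inner_waveVec_eq_zero_of_disjoint {p : ℕ} [Fact p.Prime] {γ : ℤ} {c c' j j' : ℚ_[p]}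
    (h : ¬ ‖(p : ℚ_[p]) ^ γ * (c - c')‖ ≤ 1) :
    inner ℂ (waveVec p γ c j) (waveVec p γ c' j') = 0 := by
  rw [inner_waveVec]
  refine integral_eq_zero_of_ae (Filter.Eventually.of_forall fun x => ?_)
  by_cases hx : x ∈ closedBall c ((p : ℝ) ^ γ)
  · have hx' : x ∉ closedBall c' ((p : ℝ) ^ γ) := by
      intro hx'
      rw [mem_closedBall_iff_norm] at hx hx'
      refine h (norm_zpow_mul_le_one_iff.mpr ?_)
      have := norm_sub_le_of_le hx' hx
      rwa [sub_sub_sub_cancel_left] at this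
    simp only [waveFun_eq_zero hx', mul_zero, Pi.zero_apply]
  · simp only [waveFun_eq_zero hx, map_zero, zero_mul, Pi.zero_apply]

theorem inner_waveVec_self {p : ℕ} [Fact p.Prime] (γ : ℤ) (c j : ℚ_[p]) :
    inner ℂ (waveVec p γ c j) (waveVec p γ c j) = 1 := by
  have hp := prime_pos p
  rw [inner_waveVec]
  have e1 : ∀ x, starRingEnd ℂ (waveFun p γ c j x) * waveFun p γ c j x
      = (closedBall c ((p : ℝ) ^ γ)).indicator (fun _ => (((p : ℝ) ^ (-γ) : ℝ) : ℂ)) x := by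
    intro x
    by_cases hx : x ∈ closedBall c ((p : ℝ) ^ γ)
    · rw [Set.indicator_of_mem hx, mul_comm, Complex.mul_conj, Complex.normSq_eq_norm_sq]
      rw [mem_closedBall_iff_norm, ← norm_zpow_mul_le_one_iff] at hx
      rw [waveFun, Ω_norm_of_le hx, mul_one, norm_mul, norm_χ, mul_one, Complex.norm_real,
        Real.norm_of_nonneg (by positivity), ← Real.rpow_natCast, ← Real.rpow_mul hp.le,
        ← Real.rpow_intCast]
      congr 2
      push_cast
      ring
    · rw [Set.indicator_of_notMem hx, waveFun_eq_zero hx, mul_zero]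
  simp_rw [e1]
  rw [integral_indicator measurableSet_closedBall, setIntegral_const, haar_real_closedBall,
    Complex.real_smul, ← Complex.ofReal_mul, ← zpow_add₀ hp.ne', add_neg_cancel, zpow_zero,
    Complex.ofReal_one]

theorem norm_waveVec {p : ℕ} [Fact p.Prime] (γ : ℤ) (c j : ℚ_[p]) : ‖waveVec p γ c j‖ = 1 := by
  rw [norm_eq_sqrt_re_inner (𝕜 := ℂ), inner_waveVec_self]
  simp

/-! ### Completeness -/

/-- A geometric sum of p-th roots of unity vanishes on the sphere |y| = 1 and equals p on the
smaller ball. Frequency 0, a normalized indicator of a ball, is included; this links the indicators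
of successive balls. -/
theorem sum_waveFun {p : ℕ} [Fact p.Prime] (γ : ℤ) (c x : ℚ_[p]) :
    ∑ j ∈ Finset.range p, waveFun p γ c j x
      = (((p : ℝ) ^ ((1 : ℝ) / 2) : ℝ) : ℂ) * waveFun p (γ - 1) c 0 x := by
  have hp := prime_pos p
  have hp0 := prime_ne_zero p
  set y := (p : ℚ_[p]) ^ γ * (x - c) with hy
  have hy' : (p : ℚ_[p]) ^ (γ - 1) * (x - c) = (p : ℚ_[p])⁻¹ * y := by
    rw [hy, zpow_sub_one₀ hp0]
    ring
  have e1 : ∀ j : ℕ, waveFun p γ c j x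
      = (((p : ℝ) ^ (-(γ : ℝ) / 2) : ℝ) : ℂ) * Ω ‖y‖ * χ p ((p : ℚ_[p])⁻¹ * y) ^ j := by
    intro j
    rw [waveFun, ← hy, ← χ_nsmul]
    ring_nf
  simp_rw [e1]
  rw [← Finset.mul_sum, waveFun, hy', mul_zero, zero_mul, χ_zero, mul_one]
  by_cases h1 : ‖(p : ℚ_[p])⁻¹ * y‖ ≤ 1
  · have h2 : ‖y‖ ≤ 1 := by
      have : y = p * ((p : ℚ_[p])⁻¹ * y) := by field_simp
      rw [this, norm_mul]
      exact mul_le_one₀ (by simpa using Padic.norm_int_le_one (p := p) p) (norm_nonneg _) h1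
    rw [(χ_eq_one_iff p _).mpr h1, Ω_norm_of_le h1, Ω_norm_of_le h2]
    simp only [one_pow, Finset.sum_const, Finset.card_range, nsmul_eq_mul, mul_one]
    have : (p : ℝ) ^ (-(γ : ℝ) / 2) * (p : ℝ)
        = (p : ℝ) ^ ((1 : ℝ) / 2) * (p : ℝ) ^ (-((γ - 1 : ℤ) : ℝ) / 2) := by
      rw [← Real.rpow_add hp, ← Real.rpow_add_one hp.ne']
      congr 1
      push_cast
      ring
    exact_mod_cast this
  · rw [Ω_norm_of_not_le h1, mul_zero, mul_zero]
    by_cases h2 : ‖y‖ ≤ 1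
    · have hζ : χ p ((p : ℚ_[p])⁻¹ * y) ≠ 1 := fun h => h1 ((χ_eq_one_iff p _).mp h)
      have hζp : χ p ((p : ℚ_[p])⁻¹ * y) ^ p = 1 := by
        rw [← χ_nsmul, ← mul_assoc, mul_inv_cancel₀ hp0, one_mul]
        exact (χ_eq_one_iff p _).mpr h2
      rw [geom_sum_eq hζ, hζp, sub_self, zero_div, mul_zero]
    · rw [Ω_norm_of_not_le h2, mul_zero, zero_mul]

theorem toLp_eq_sum_smul {α ι : Type*} [MeasurableSpace α] {μ : Measure α} (s : Finset ι)
    (a : ι → ℂ) {F : ι → α → ℂ} (hF : ∀ i, MemLp (F i) 2 μ) {g : α → ℂ} (hg : MemLp g 2 μ)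
    (h : ∀ x, g x = ∑ i ∈ s, a i * F i x) : hg.toLp = ∑ i ∈ s, a i • (hF i).toLp := by
  have key : ∀ s : Finset ι, (⇑(∑ i ∈ s, a i • (hF i).toLp) : α → ℂ)
      =ᵐ[μ] fun x => ∑ i ∈ s, a i * F i x := by
    classical
    intro s
    induction s using Finset.induction_on with
    | empty =>
      simp only [Finset.sum_empty]
      exact Lp.coeFn_zero _ _ _
    | insert j s hj ih =>
      rw [Finset.sum_insert hj]
      filter_upwards [Lp.coeFn_add (a j • (hF j).toLp) (∑ i ∈ s, a i • (hF i).toLp),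
        Lp.coeFn_smul (a j) (hF j).toLp, (hF j).coeFn_toLp, ih] with x h1 h2 h3 h4
      rw [h1, Pi.add_apply, h2, Pi.smul_apply, h3, h4, Finset.sum_insert hj, smul_eq_mul]
  refine Lp.ext ?_
  filter_upwards [hg.coeFn_toLp, key s] with x h1 h2
  rw [h1, h2, h]

theorem sum_waveVec {p : ℕ} [Fact p.Prime] (γ : ℤ) (c : ℚ_[p]) :
    ∑ j ∈ Finset.range p, waveVec p γ c j
      = (((p : ℝ) ^ ((1 : ℝ) / 2) : ℝ) : ℂ) • waveVec p (γ - 1) c 0 := by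
  have h := toLp_eq_sum_smul (Finset.range p) (fun _ => 1)
    (fun j : ℕ => memLp_waveFun p γ c (j : ℚ_[p]))
    ((memLp_waveFun p (γ - 1) c 0).const_smul (((p : ℝ) ^ ((1 : ℝ) / 2) : ℝ) : ℂ))
    (fun x => by simp_rw [one_mul]; exact (sum_waveFun γ c x).symm)
  rw [MemLp.toLp_const_smul] at h
  simp_rw [one_smul] at h
  exact h.symm

/-- If h is orthogonal to all frequencies 1, …, p-1, then `sum_waveVec` makes its pairing with the
normalized indicator grow by √p with each enlargement of the ball. Cauchy–Schwarz bounds these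
pairings by ‖h‖, so they vanish. -/
theorem inner_waveVec_zero_eq_zero {p : ℕ} [Fact p.Prime] {h : L2 p}
    (hh : ∀ (γ : ℤ) (c : ℚ_[p]) (j : ℕ), 1 ≤ j → j < p → inner ℂ (waveVec p γ c j) h = 0)
    (γ : ℤ) (c : ℚ_[p]) : inner ℂ (waveVec p γ c 0) h = 0 := by
  have hp := one_lt_prime p
  set q : ℝ := (p : ℝ) ^ ((1 : ℝ) / 2) with hq
  have hq1 : 1 < q := Real.one_lt_rpow hp (by norm_num)
  have step : ∀ γ : ℤ, ‖(inner ℂ (waveVec p γ c 0) h : ℂ)‖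
      = q * ‖(inner ℂ (waveVec p (γ - 1) c 0) h : ℂ)‖ := by
    intro γ
    have h1 := congrArg (fun v : L2 p => (inner ℂ v h : ℂ)) (sum_waveVec γ c)
    rw [sum_inner, Finset.sum_eq_single 0, inner_smul_left, Complex.conj_ofReal] at h1
    · rw [← hq] at h1
      rw [Nat.cast_zero] at h1
      rw [h1, norm_mul, Complex.norm_real, Real.norm_of_nonneg (by linarith)]
    · intro j hj hj0
      exact hh γ c j (Nat.one_le_iff_ne_zero.mpr hj0) (Finset.mem_range.mp hj)
    · intro h0
      exact absurd (Finset.mem_range.mpr (Fact.out : p.Prime).pos) h0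
  have iter : ∀ m : ℕ, ‖(inner ℂ (waveVec p (γ + m) c 0) h : ℂ)‖
      = q ^ m * ‖(inner ℂ (waveVec p γ c 0) h : ℂ)‖ := by
    intro m
    induction m with
    | zero => simp
    | succ m ih =>
      rw [step, pow_succ', mul_assoc, ← ih]
      congr 5
      push_cast
      ring
  by_contra hne
  have hpos : 0 < ‖(inner ℂ (waveVec p γ c 0) h : ℂ)‖ := norm_pos_iff.mpr hne
  obtain ⟨m, hm⟩ := pow_unbounded_of_one_lt (‖h‖ / ‖(inner ℂ (waveVec p γ c 0) h : ℂ)‖) hq1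
  rw [div_lt_iff₀ hpos, ← iter] at hm
  have := norm_inner_le_norm (𝕜 := ℂ) (waveVec p (γ + m) c 0) h
  rw [norm_waveVec, one_mul] at this
  linarith

/-- Doubling makes the Lebesgue differentiation theorem available in `eq_zero_of_inner_waveVec`. -/
instance instIsUnifLocDoublingMeasureHaar (p : ℕ) [Fact p.Prime] :
    IsUnifLocDoublingMeasure (haar p) := by
  have hp := one_lt_prime p
  have hp0 := prime_pos p
  -- With p^γ ≤ ε < p^(γ+1) and 2 ≤ p, the radius 2ε is at most p^(γ+2), two powers above p^γ.
  refine ⟨⟨(p : NNReal) ^ 2, ?_⟩⟩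
  filter_upwards [self_mem_nhdsWithin] with ε (hε : 0 < ε) x
  obtain ⟨γ, h1, h2⟩ := exists_mem_Ico_zpow hε hp
  have hle : 2 * ε ≤ (p : ℝ) ^ (γ + 2) := by
    have h2p : (2 : ℝ) ≤ p := by exact_mod_cast (Fact.out : p.Prime).two_le
    have : (p : ℝ) ^ (γ + 2) = p * (p : ℝ) ^ (γ + 1) := by
      rw [← zpow_one_add₀ hp0.ne']
      congr 1
      ring
    rw [this]
    exact mul_le_mul h2p h2.le hε.le hp0.le
  have meas : ∀ γ : ℤ, haar p (closedBall x ((p : ℝ) ^ γ)) = ENNReal.ofReal ((p : ℝ) ^ γ) := by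
    intro γ
    refine Eq.trans ?_ (congrArg ENNReal.ofReal (haar_real_closedBall p γ x))
    rw [measureReal_def, ENNReal.ofReal_toReal (isCompact_closedBall _ _).measure_lt_top.ne]
  calc haar p (closedBall x (2 * ε)) ≤ haar p (closedBall x ((p : ℝ) ^ (γ + 2))) :=
        measure_mono (closedBall_subset_closedBall hle)
    _ = ((p : NNReal) ^ 2 : NNReal) * haar p (closedBall x ((p : ℝ) ^ γ)) := by
        rw [meas, meas, zpow_add₀ hp0.ne', mul_comm, ENNReal.ofReal_mul (by positivity)]
        congr 1
        norm_cast
    _ ≤ _ := by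
        gcongr

/-- All integrals of h over balls vanish, and by Lebesgue differentiation h is almost everywhere the
limit of its averages over shrinking balls. -/
theorem eq_zero_of_inner_waveVec {p : ℕ} [Fact p.Prime] {h : L2 p}
    (hh : ∀ (γ : ℤ) (c : ℚ_[p]), inner ℂ (waveVec p γ c 0) h = 0) : h = 0 := by
  have hp := one_lt_prime p
  have hp0 := prime_pos p
  have hint : ∀ (γ : ℤ) (c : ℚ_[p]), ∫ x in closedBall c ((p : ℝ) ^ γ), h x ∂(haar p) = 0 := by
    intro γ c
    have h0 := hh γ c
    have e1 : waveVec p γ c 0 = (((p : ℝ) ^ (-(γ : ℝ) / 2) : ℝ) : ℂ) •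
        indicatorConstLp 2 (measurableSet_closedBall (x := c) (ε := (p : ℝ) ^ γ))
          (isCompact_closedBall _ _).measure_lt_top.ne (1 : ℂ) := by
      rw [indicatorConstLp, waveVec, ← MemLp.toLp_const_smul]
      congr 1
      funext x
      simp only [Pi.smul_apply, smul_eq_mul]
      by_cases hx : x ∈ closedBall c ((p : ℝ) ^ γ)
      · rw [Set.indicator_of_mem hx]
        rw [mem_closedBall_iff_norm, ← norm_zpow_mul_le_one_iff] at hx
        rw [waveFun, Ω_norm_of_le hx, mul_zero, zero_mul, χ_zero, mul_one]
      · rw [Set.indicator_of_notMem hx, waveFun_eq_zero hx, mul_zero]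
    rw [e1, inner_smul_left, L2.inner_indicatorConstLp_one] at h0
    refine (mul_eq_zero.mp h0).resolve_left ?_
    rw [Complex.conj_ofReal]
    exact Complex.ofReal_ne_zero.mpr (Real.rpow_pos_of_pos hp0 _).ne'
  refine Lp.eq_zero_iff_ae_eq_zero.mpr ?_
  have hloc : LocallyIntegrable h (haar p) := (Lp.memLp h).locallyIntegrable (by norm_num)
  filter_upwards [IsUnifLocDoublingMeasure.ae_tendsto_average (μ := haar p) hloc 1] with x hx
  have hδ : Filter.Tendsto (fun n : ℕ => (p : ℝ) ^ (-(n : ℤ))) Filter.atTop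
      (nhdsWithin 0 (Set.Ioi 0)) := by
    rw [tendsto_nhdsWithin_iff]
    refine ⟨?_, Filter.Eventually.of_forall fun n => Set.mem_Ioi.mpr (by positivity)⟩
    simp_rw [zpow_neg, zpow_natCast, ← inv_pow]
    exact tendsto_pow_atTop_nhds_zero_of_lt_one (by positivity) (inv_lt_one_of_one_lt₀ hp)
  have := hx (fun _ => x) _ hδ (Filter.Eventually.of_forall fun n =>
    mem_closedBall_self (by positivity))
  simp_rw [setAverage_eq, hint, smul_zero] at this
  exact tendsto_nhds_unique this tendsto_const_nhds

/-! ### The orthonormal basis of wavelets -/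

/-- The wavelets as vectors of `L²(ℚ_p)`. -/
def waveletVec (p : ℕ) [Fact p.Prime] (l : WaveletIndex p) : L2 p := waveVec p l.γ (center l) l.j

theorem prime_zpow_mul_center {p : ℕ} [Fact p.Prime] (l : WaveletIndex p) :
    (p : ℚ_[p]) ^ l.γ * center l = l.n := by
  rw [center, ← mul_assoc, ← zpow_add₀ (prime_ne_zero p), add_neg_cancel, zpow_zero, one_mul]

theorem norm_natCast_eq_one {p : ℕ} [Fact p.Prime] {j : ℕ} (h : ¬ p ∣ j) :
    ‖(j : ℚ_[p])‖ = 1 := by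
  rw [Padic.norm_natCast_eq_one_iff]
  exact ((Fact.out : p.Prime).coprime_iff_not_dvd).mpr h

theorem WaveletIndex.norm_j {p : ℕ} [Fact p.Prime] (l : WaveletIndex p) : ‖(l.j : ℚ_[p])‖ = 1 :=
  norm_natCast_eq_one (Nat.not_dvd_of_pos_of_lt l.j_pos l.j_lt)

theorem χ_ne_one_of_norm_eq {p : ℕ} [Fact p.Prime] {x : ℚ_[p]} (h : ‖x‖ = p) : χ p x ≠ 1 := by
  rw [Ne, χ_eq_one_iff, h, not_le]
  exact one_lt_prime p

theorem χ_ne_of_norm_sub_eq {p : ℕ} [Fact p.Prime] {x y : ℚ_[p]} (h : ‖x - y‖ = p) :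
    χ p x ≠ χ p y := by
  intro h'
  refine χ_ne_one_of_norm_eq h (mul_right_cancel₀ (χ_ne_zero p y) ?_)
  rw [← χ_add, sub_add_cancel, h', one_mul]

theorem norm_natCast_sub_eq_one {p : ℕ} [Fact p.Prime] {j j' : ℕ} (h : j < p) (h' : j' < p)
    (hne : j ≠ j') : ‖(j : ℚ_[p]) - j'‖ = 1 := by
  have h1 : ‖(((j : ℤ) - j' : ℤ) : ℚ_[p])‖ ≤ 1 := Padic.norm_int_le_one _
  push_cast at h1
  refine le_antisymm h1 ?_
  by_contra hlt
  rw [not_le] at hlt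
  refine hne (nat_eq_of_norm_sub_le (p := p) (N := 1) (by simpa) (by simpa) ?_)
  rw [Padic.norm_le_pow_iff_norm_lt_pow_add_one]
  simpa using hlt

/-- Distinct wavelets are separated by a phase or by their supports. -/
theorem exists_translation_of_ne {p : ℕ} [Fact p.Prime] {γ γ' : ℤ} {j j' : ℕ}
    (hj : 1 ≤ j) (hjp : j < p) (hj' : 1 ≤ j') (hjp' : j' < p) (h : γ ≠ γ' ∨ j ≠ j') :
    ∃ e : ℚ_[p], ‖(p : ℚ_[p]) ^ γ * e‖ ≤ 1 ∧ ‖(p : ℚ_[p]) ^ γ' * e‖ ≤ 1 ∧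
      ‖(p : ℚ_[p])⁻¹ * j * ((p : ℚ_[p]) ^ γ * e)
        - (p : ℚ_[p])⁻¹ * j' * ((p : ℚ_[p]) ^ γ' * e)‖ = p := by
  have hp := one_lt_prime p
  have hp0 := prime_pos p
  have hpp := prime_ne_zero p
  have main : ∀ {γ γ' : ℤ} {j j' : ℕ}, 1 ≤ j → j < p → γ < γ' →
      ∃ e : ℚ_[p], ‖(p : ℚ_[p]) ^ γ * e‖ ≤ 1 ∧ ‖(p : ℚ_[p]) ^ γ' * e‖ ≤ 1 ∧
      ‖(p : ℚ_[p])⁻¹ * j * ((p : ℚ_[p]) ^ γ * e)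
        - (p : ℚ_[p])⁻¹ * j' * ((p : ℚ_[p]) ^ γ' * e)‖ = p := by
    intro γ γ' j j' hj hjp hlt
    have hn1 : ‖(p : ℚ_[p])⁻¹ * j * ((p : ℚ_[p]) ^ γ * (p : ℚ_[p]) ^ (-γ))‖ = p := by
      rw [← zpow_add₀ hpp, add_neg_cancel, zpow_zero, mul_one, norm_mul, norm_inv, Padic.norm_p,
        norm_natCast_eq_one (Nat.not_dvd_of_pos_of_lt hj hjp), inv_inv, mul_one]
    have hn2 : ‖(p : ℚ_[p])⁻¹ * j' * ((p : ℚ_[p]) ^ γ' * (p : ℚ_[p]) ^ (-γ))‖ ≤ 1 := by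
      have : (p : ℚ_[p])⁻¹ * j' * ((p : ℚ_[p]) ^ γ' * (p : ℚ_[p]) ^ (-γ))
          = j' * (p : ℚ_[p]) ^ (γ' - γ - 1) := by
        rw [zpow_sub_one₀ hpp, sub_eq_add_neg, zpow_add₀ hpp]
        ring
      rw [this, norm_mul, norm_prime_zpow]
      exact mul_le_one₀ (by simpa using Padic.norm_int_le_one (p := p) j') (by positivity)
        (zpow_le_one_of_nonpos₀ hp.le (by lia))
    -- Translation by the radius of the smaller ball: the finer wave gets a phase argument of norm
    -- p, while the argument for the coarser wave lies in ℤ_p. By the ultrametric inequality the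
    -- difference has norm p.
    refine ⟨(p : ℚ_[p]) ^ (-γ), ?_, ?_, ?_⟩
    · rw [norm_zpow_mul_le_one_iff, norm_prime_zpow, neg_neg]
    · rw [norm_zpow_mul_le_one_iff, norm_prime_zpow, neg_neg]
      exact zpow_le_zpow_right₀ hp.le hlt.le
    · refine le_antisymm (norm_sub_le_of_le hn1.le (hn2.trans hp.le)) ?_
      by_contra hcon
      have := norm_le_of_norm_sub_le (r := max ‖(p : ℚ_[p])⁻¹ * j * ((p : ℚ_[p]) ^ γ *
        (p : ℚ_[p]) ^ (-γ)) - (p : ℚ_[p])⁻¹ * j' * ((p : ℚ_[p]) ^ γ' * (p : ℚ_[p]) ^ (-γ))‖ 1)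
        (le_max_left _ _) (hn2.trans (le_max_right _ _))
      rw [hn1] at this
      exact absurd this (not_le.mpr (max_lt (not_le.mp hcon) hp))
  rcases lt_trichotomy γ γ' with hlt | rfl | hlt
  · exact main hj hjp hlt
  · have hne : j ≠ j' := by simpa using h
    refine ⟨(p : ℚ_[p]) ^ (-γ), ?_, ?_, ?_⟩
    · rw [norm_zpow_mul_le_one_iff, norm_prime_zpow, neg_neg]
    · rw [norm_zpow_mul_le_one_iff, norm_prime_zpow, neg_neg]
    · rw [← zpow_add₀ hpp, add_neg_cancel, zpow_zero, mul_one, mul_one, ← mul_sub, norm_mul,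
        norm_natCast_sub_eq_one hjp hjp' hne, norm_inv, Padic.norm_p, inv_inv, mul_one]
  · obtain ⟨e, h1, h2, h3⟩ := main (j' := j) hj' hjp' hlt
    exact ⟨e, h2, h1, by rw [norm_sub_rev, h3]⟩

theorem orthonormal_waveletVec (p : ℕ) [Fact p.Prime] : Orthonormal ℂ (waveletVec p) := by
  refine ⟨fun l => norm_waveVec _ _ _, fun l l' hne => ?_⟩
  change inner ℂ (waveVec p l.γ (center l) l.j) (waveVec p l'.γ (center l') l'.j) = 0
  by_cases h : l.γ ≠ l'.γ ∨ l.j ≠ l'.j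
  · obtain ⟨e, h1, h2, h3⟩ := exists_translation_of_ne l.j_pos l.j_lt l'.j_pos l'.j_lt h
    exact inner_waveVec_eq_zero_of_translation h1 h2 (χ_ne_of_norm_sub_eq h3)
  · push Not at h
    obtain ⟨hγ, hj⟩ := h
    rw [hγ]
    refine inner_waveVec_eq_zero_of_disjoint fun hle => hne ?_
    rw [mul_sub, ← hγ, prime_zpow_mul_center, hγ, prime_zpow_mul_center] at hle
    exact WaveletIndex.ext hγ
      (eq_of_mem_digitReps l.n_mem l'.n_mem (by rwa [neg_zero, zpow_zero])) hj

/-- The wavelet with a given scale and frequency whose support contains a given point. -/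
def waveletAt (p : ℕ) [Fact p.Prime] (γ : ℤ) (c : ℚ_[p]) (j : ℕ) (hj : 1 ≤ j) (hjp : j < p) :
    WaveletIndex p := ⟨γ, digitRep p 0 ((p : ℚ_[p]) ^ γ * c), j, digitRep_mem _ _ _, hj, hjp⟩

theorem norm_center_waveletAt {p : ℕ} [Fact p.Prime] (γ : ℤ) (c : ℚ_[p]) (j : ℕ) (hj : 1 ≤ j)
    (hjp : j < p) :
    ‖(p : ℚ_[p]) ^ γ * (center (waveletAt p γ c j hj hjp) - c)‖ ≤ 1 := by
  have h := prime_zpow_mul_center (waveletAt p γ c j hj hjp)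
  change (p : ℚ_[p]) ^ γ * _ = digitRep p 0 ((p : ℚ_[p]) ^ γ * c) at h
  have h2 := norm_sub_digitRep p 0 ((p : ℚ_[p]) ^ γ * c)
  rw [mul_sub, h, norm_sub_rev]
  simpa using h2

/-- The wavelets form an orthonormal basis of `L²(ℚ_p)`. -/
def waveletBasis (p : ℕ) [Fact p.Prime] : HilbertBasis (WaveletIndex p) ℂ (L2 p) :=
  HilbertBasis.mkOfOrthogonalEqBot (orthonormal_waveletVec p) <| by
    rw [Submodule.eq_bot_iff]
    intro h hh
    rw [Submodule.mem_orthogonal] at hh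
    refine eq_zero_of_inner_waveVec (inner_waveVec_zero_eq_zero fun γ c j hj hjp => ?_)
    rw [waveVec_congr (norm_center_waveletAt γ c j hj hjp) (by simp : ‖(j : ℚ_[p]) - j‖ ≤ _),
      inner_smul_left]
    have : (inner ℂ (waveletVec p (waveletAt p γ c j hj hjp)) h : ℂ) = 0 :=
      hh _ (Submodule.subset_span ⟨_, rfl⟩)
    change _ * (inner ℂ (waveletVec p (waveletAt p γ c j hj hjp)) h : ℂ) = 0
    rw [this, mul_zero]

theorem coe_waveletBasis (p : ℕ) [Fact p.Prime] : ⇑(waveletBasis p) = waveletVec p :=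
  HilbertBasis.coe_mkOfOrthogonalEqBot _ _

/-! ### The orbit of a wavelet and permutations of its parameters -/

/-- The image `G(p^γ J, p^γ J n) ψ_i` of a wavelet, as a vector of `L²(ℚ_p)`. -/
def orbitWave {p : ℕ} [Fact p.Prime] (i : WaveletIndex p) (γ : ℤ) (n J : ℚ_[p]) : L2 p :=
  waveVec p (i.γ - γ) ((p : ℚ_[p]) ^ γ * J * (n + center i)) (i.j / J)

theorem orbitVec_eq_sum {p : ℕ} [Fact p.Prime] {f : ℚ_[p] → ℂ} (hf : IsD0 p f)
    {C : WaveletIndex p →₀ ℂ} (hfC : ∀ x : ℚ_[p], f x = ∑ i ∈ C.support, C i * wavelet p i x)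
    {γ₀ : ℤ} {γA : ℕ} (t : OrbitIndex p γ₀ γA) :
    orbitVec hf t = ∑ i ∈ C.support, C i • orbitWave i t.γ t.n t.J := by
  refine toLp_eq_sum_smul C.support C (fun i : WaveletIndex p => memLp_waveFun p (i.γ - t.γ)
    ((p : ℚ_[p]) ^ t.γ * t.J * (t.n + center i)) (i.j / t.J)) (memLp_affineAct p _ _ hf)
    fun x => ?_
  rw [affineAct, hfC, Finset.mul_sum]
  refine Finset.sum_congr rfl fun i _ => ?_
  rw [← affineAct_waveFun i.γ t.γ (norm_natCast_eq_one t.not_dvd) t.n, affineAct,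
    wavelet_eq_waveFun]
  ring

theorem orbitWave_congr {p : ℕ} [Fact p.Prime] (i : WaveletIndex p) (γ : ℤ) {n n' J J' : ℚ_[p]}
    (hJ : ‖J‖ = 1) (hJ' : ‖J'‖ = 1) (hJJ' : ‖J' - J‖ ≤ (p : ℝ)⁻¹)
    (h : ‖(p : ℚ_[p]) ^ i.γ * (J * (n + center i) - J' * (n' + center i))‖ ≤ 1) :
    orbitWave i γ n' J' = χ p ((p : ℚ_[p])⁻¹ * (i.j / J) *
      ((p : ℚ_[p]) ^ i.γ * (J * (n + center i) - J' * (n' + center i)))) • orbitWave i γ n J := by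
  have hp0 := prime_ne_zero p
  have hJ0 : J ≠ 0 := norm_ne_zero_iff.mp (by rw [hJ]; exact one_ne_zero)
  have hJ0' : J' ≠ 0 := norm_ne_zero_iff.mp (by rw [hJ']; exact one_ne_zero)
  have e : (p : ℚ_[p]) ^ (i.γ - γ) * ((p : ℚ_[p]) ^ γ * J * (n + center i)
      - (p : ℚ_[p]) ^ γ * J' * (n' + center i))
      = (p : ℚ_[p]) ^ i.γ * (J * (n + center i) - J' * (n' + center i)) := by
    rw [zpow_sub₀ hp0]
    field_simp
  rw [← e] at h ⊢
  refine waveVec_congr h ?_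
  rw [div_sub_div _ _ hJ0' hJ0, norm_div, norm_mul J' J, hJ, hJ', mul_comm J', ← mul_sub, norm_mul,
    i.norm_j, one_mul, mul_one, div_one, norm_sub_rev]
  exact hJJ'

theorem orbitWave_congr_left {p : ℕ} [Fact p.Prime] (i : WaveletIndex p) (γ : ℤ) {n n' J : ℚ_[p]}
    (hJ : ‖J‖ = 1) (h : ‖(p : ℚ_[p]) ^ i.γ * (n - n')‖ ≤ 1) :
    orbitWave i γ n' J
      = χ p ((p : ℚ_[p])⁻¹ * i.j * ((p : ℚ_[p]) ^ i.γ * (n - n'))) • orbitWave i γ n J := by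
  have hJ0 : J ≠ 0 := norm_ne_zero_iff.mp (by rw [hJ]; exact one_ne_zero)
  have e : (p : ℚ_[p]) ^ i.γ * (J * (n + center i) - J * (n' + center i))
      = J * ((p : ℚ_[p]) ^ i.γ * (n - n')) := by ring
  rw [orbitWave_congr i γ (n := n) hJ hJ (by simp) (by rwa [e, norm_mul, hJ, one_mul]), e]
  congr 2
  field_simp

/-- Changing n by p^(1-γ₀) ℤ_p moves the center by at most 1/p of the radius, so even the phase is
1. This is why n is taken modulo p^(1-γ₀) ℤ_p with γ₀ the minimal scale. -/
theorem orbitWave_digitRep {p : ℕ} [Fact p.Prime] (i : WaveletIndex p) (γ : ℤ) (n : ℚ_[p])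
    {J : ℚ_[p]} (hJ : ‖J‖ = 1) {γ₀ : ℤ} (h : γ₀ ≤ i.γ) :
    orbitWave i γ (digitRep p (1 - γ₀) n) J = orbitWave i γ n J := by
  have hp := one_lt_prime p
  have hp0 := prime_pos p
  have h1 : ‖(p : ℚ_[p]) ^ i.γ * (n - digitRep p (1 - γ₀) n)‖ ≤ (p : ℝ)⁻¹ := by
    rw [norm_mul, norm_prime_zpow, zpow_neg, inv_mul_le_iff₀ (by positivity), ← zpow_neg_one,
      ← zpow_add₀ hp0.ne']
    exact (norm_sub_digitRep p (1 - γ₀) n).trans (zpow_le_zpow_right₀ hp.le (by lia))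
  rw [orbitWave_congr_left i γ hJ (h1.trans (inv_le_one_of_one_le₀ hp.le)),
    (χ_eq_one_iff p _).mpr, one_smul]
  rw [mul_right_comm, norm_mul, i.norm_j, mul_one]
  exact norm_inv_prime_mul_le_one h1

theorem OrbitIndex.norm_J {p : ℕ} [Fact p.Prime] {γ₀ : ℤ} {γA : ℕ} (t : OrbitIndex p γ₀ γA) :
    ‖(t.J : ℚ_[p])‖ = 1 := norm_natCast_eq_one t.not_dvd

theorem not_dvd_mul_mod {p A w J : ℕ} (hp : p.Prime) (hA : 1 ≤ A) (hw : w.Coprime p)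
    (hJ : ¬ p ∣ J) : ¬ p ∣ J * w % p ^ A := by
  rw [Nat.dvd_mod_iff (dvd_pow_self p (by lia)), hp.dvd_mul]
  rintro (h | h)
  · exact hJ h
  · exact (hp.coprime_iff_not_dvd.mp hw.symm) h

/-- Affine substitutions `(n, J) ↦ (u_J n + d_J, w J)` permute the parameters of the orbit. -/
theorem exists_orbitPerm {p : ℕ} [Fact p.Prime] (γ₀ : ℤ) {A : ℕ} (hA : 1 ≤ A) {w : ℕ}
    (hw : w.Coprime p) (u d : ℕ → ℚ_[p]) (hu : ∀ J, ¬ p ∣ J → ‖u J‖ = 1) :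
    ∃ τ : Equiv.Perm (OrbitIndex p γ₀ A), ∀ t, (τ t).γ = t.γ ∧ (τ t).J = t.J * w % p ^ A ∧
      (τ t).n = digitRep p (1 - γ₀) (u t.J * t.n + d t.J) := by
  have hp : p.Prime := Fact.out
  have hpA : 0 < p ^ A := pow_pos hp.pos A
  have hpA1 : 1 < p ^ A := Nat.one_lt_pow (by lia) hp.one_lt
  have hwA : w.Coprime (p ^ A) := hw.pow_right A
  obtain ⟨w', -, hw'⟩ := Nat.exists_mul_mod_eq_one_of_coprime hwA hpA1
  have hww' : w' * w ≡ 1 [MOD p ^ A] := by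
    rw [Nat.ModEq, mul_comm, hw', Nat.mod_eq_of_lt hpA1]
  have hw'p : w'.Coprime p := by
    rw [Nat.coprime_comm, hp.coprime_iff_not_dvd]
    intro h
    have h1 := (Nat.ModEq.dvd_iff hww' (dvd_pow_self p (by lia))).mp (h.mul_right w)
    exact hp.one_lt.ne' (Nat.dvd_one.mp h1)
  let φ : OrbitIndex p γ₀ A → OrbitIndex p γ₀ A := fun t =>
    ⟨t.γ, digitRep p (1 - γ₀) (u t.J * t.n + d t.J), t.J * w % p ^ A, digitRep_mem _ _ _,
      Nat.mod_lt _ hpA, not_dvd_mul_mod hp hA hw t.not_dvd⟩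
  have hφ : Function.Bijective φ := by
    constructor
    · intro t t' h
      have hJ : t.J = t'.J := by
        have h1 : t.J * w ≡ t'.J * w [MOD p ^ A] := congrArg OrbitIndex.J h
        exact (Nat.ModEq.cancel_right_of_coprime hwA.symm h1).eq_of_lt_of_lt t.J_lt t'.J_lt
      refine OrbitIndex.ext (congrArg OrbitIndex.γ h :) (eq_of_mem_digitReps t.n_mem t'.n_mem ?_) hJ
      have hn : digitRep p (1 - γ₀) (u t.J * t.n + d t.J)
          = digitRep p (1 - γ₀) (u t'.J * t'.n + d t'.J) := congrArg OrbitIndex.n h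
      have h1 := norm_sub_digitRep p (1 - γ₀) (u t.J * t.n + d t.J)
      have h2 := norm_sub_digitRep p (1 - γ₀) (u t'.J * t'.n + d t'.J)
      rw [← hn] at h2
      have h3 := norm_sub_le_of_le h1 h2
      rwa [sub_sub_sub_cancel_right, ← hJ, add_sub_add_right_eq_sub, ← mul_sub, norm_mul,
        hu _ t.not_dvd, one_mul] at h3
    · intro t
      have hJ := not_dvd_mul_mod hp hA hw'p t.not_dvd
      set J := t.J * w' % p ^ A with hJdef
      have hu0 : u J ≠ 0 := norm_ne_zero_iff.mp (by rw [hu J hJ]; exact one_ne_zero)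
      refine ⟨⟨t.γ, digitRep p (1 - γ₀) ((u J)⁻¹ * (t.n - d J)), J, digitRep_mem _ _ _,
        Nat.mod_lt _ hpA, hJ⟩, OrbitIndex.ext rfl (digitRep_eq t.n_mem ?_) ?_⟩
      · have h1 := norm_sub_digitRep p (1 - γ₀) ((u J)⁻¹ * (t.n - d J))
        rw [← one_mul ‖_‖, ← hu J hJ, ← norm_mul, mul_sub, mul_inv_cancel_left₀ hu0,
          norm_sub_rev, sub_sub_eq_add_sub] at h1
        exact h1
      · have h1 : J * w ≡ t.J [MOD p ^ A] := by
          calc J * w ≡ t.J * w' * w [MOD p ^ A] := (Nat.mod_modEq _ _).mul_right w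
            _ = t.J * (w' * w) := mul_assoc _ _ _
            _ ≡ t.J * 1 [MOD p ^ A] := hww'.mul_left _
            _ = t.J := mul_one _
        exact Eq.trans h1 (Nat.mod_eq_of_lt t.J_lt)
  exact ⟨Equiv.ofBijective φ hφ, fun t => ⟨rfl, rfl, rfl⟩⟩

theorem gammaA_isLeast {p : ℕ} [Fact p.Prime] (C : WaveletIndex p →₀ ℂ) :
    IsLeast (stabRadii C) ((p : ℝ) ^ (-(gammaA C : ℤ))) := Classical.choose_spec (exists_gammaA C)

theorem one_le_gammaA {p : ℕ} [Fact p.Prime] (C : WaveletIndex p →₀ ℂ) : 1 ≤ gammaA C := by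
  have h := (gammaA_isLeast C).2 (Or.inl rfl : (p : ℝ)⁻¹ ∈ stabRadii C)
  rw [← zpow_neg_one, zpow_le_zpow_iff_right₀ (one_lt_prime p)] at h
  lia

theorem gammaMin_le {p : ℕ} [Fact p.Prime] {C : WaveletIndex p →₀ ℂ} (hC : C ≠ 0)
    {i : WaveletIndex p} (hi : i ∈ C.support) : gammaMin C hC ≤ i.γ :=
  Finset.min'_le _ _ (Finset.mem_image_of_mem _ hi)

/-- Distance of the centers of two different wavelets of the same scale and frequency. -/
theorem exists_norm_center_sub {p : ℕ} [Fact p.Prime] {C : WaveletIndex p →₀ ℂ}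
    {i k : WaveletIndex p} (hi : i ∈ C.support) (hk : k ∈ C.support) (hγ : i.γ = k.γ)
    (hj : i.j = k.j) (hik : i ≠ k) :
    ∃ s : ℕ, 1 ≤ s ∧ s + 1 ≤ gammaA C ∧ ‖center i - center k‖ = (p : ℝ) ^ (i.γ + s) := by
  have hp := one_lt_prime p
  have hp0 := prime_pos p
  have h1 : ¬ ‖center i - center k‖ ≤ (p : ℝ) ^ i.γ := by
    intro h
    rw [← norm_zpow_mul_le_one_iff, mul_sub, prime_zpow_mul_center, hγ,
      prime_zpow_mul_center] at h
    exact hik (WaveletIndex.ext hγ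
      (eq_of_mem_digitReps i.n_mem k.n_mem (by rwa [neg_zero, zpow_zero])) hj)
  have hne : center i - center k ≠ 0 := by
    intro h
    rw [h, norm_zero] at h1
    exact h1 (by positivity)
  -- For equal scales and distance p^(γ_i + s) the ratio in `stabRadii` is p^(-1-s), and its
  -- minimality bound reads s + 1 ≤ γ_A.
  have h2 := (gammaA_isLeast C).2 (Or.inr ⟨i, hi, k, hk, hne, rfl⟩)
  rw [← hγ, max_self] at h2
  rw [Padic.norm_eq_zpow_neg_valuation hne] at h1 h2 ⊢
  rw [zpow_le_zpow_iff_right₀ hp] at h1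
  rw [← zpow_sub₀ hp0.ne', zpow_le_zpow_iff_right₀ hp] at h2
  obtain ⟨s, hs⟩ := Int.eq_ofNat_of_zero_le
    (show 0 ≤ -(center i - center k).valuation - i.γ by lia)
  exact ⟨s, by lia, by lia, by rw [← hs]; congr 1; ring⟩

/-- The orbits of different wavelets are exchanged by a permutation with different phases. -/
theorem exists_orbitPerm_phase {p : ℕ} [Fact p.Prime] {C : WaveletIndex p →₀ ℂ} (hC : C ≠ 0)
    {i k : WaveletIndex p} (hi : i ∈ C.support) (hk : k ∈ C.support) (hik : i ≠ k) :
    ∃ (τ : Equiv.Perm (OrbitIndex p (gammaMin C hC) (gammaA C))) (x y : ℚ_[p]), ‖x - y‖ = p ∧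
      (∀ t, orbitWave i (τ t).γ (τ t).n (τ t).J = χ p x • orbitWave i t.γ t.n t.J) ∧
      ∀ t, orbitWave k (τ t).γ (τ t).n (τ t).J = χ p y • orbitWave k t.γ t.n t.J := by
  have hp := one_lt_prime p
  have hp0 := prime_pos p
  have hpp := prime_ne_zero p
  have hA := one_le_gammaA C
  by_cases h : i.γ ≠ k.γ ∨ i.j ≠ k.j
  · obtain ⟨e, h1, h2, h3⟩ := exists_translation_of_ne i.j_pos i.j_lt k.j_pos k.j_lt h
    obtain ⟨τ, hτ⟩ := exists_orbitPerm (gammaMin C hC) hA (Nat.coprime_one_left p)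
      (fun _ => (1 : ℚ_[p])) (fun _ => e) (fun _ _ => norm_one)
    have main : ∀ l ∈ C.support, ‖(p : ℚ_[p]) ^ l.γ * e‖ ≤ 1 → ∀ t,
        orbitWave l (τ t).γ (τ t).n (τ t).J
          = χ p (-((p : ℚ_[p])⁻¹ * l.j * ((p : ℚ_[p]) ^ l.γ * e)))
            • orbitWave l t.γ t.n t.J := by
      intro l hl hle t
      obtain ⟨e1, e2, e3⟩ := hτ t
      rw [mul_one, Nat.mod_eq_of_lt t.J_lt] at e2
      have e4 : t.n - (t.n + e) = -e := by ring
      rw [e1, e2, e3, one_mul, orbitWave_digitRep l _ _ t.norm_J (gammaMin_le hC hl),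
        orbitWave_congr_left l t.γ (n := t.n) t.norm_J
          (by rwa [e4, mul_neg, norm_neg]), e4, mul_neg, mul_neg]
    refine ⟨τ, _, _, ?_, main i hi h1, main k hk h2⟩
    rw [neg_sub_neg, norm_sub_rev, h3]
  · push Not at h
    obtain ⟨hγ, hj⟩ := h
    obtain ⟨s, hs1, hsA, hs⟩ := exists_norm_center_sub hi hk hγ hj hik
    set A := gammaA C with hAdef
    have hw : (1 + p ^ s).Coprime p := by
      rw [Nat.coprime_comm, (Fact.out : p.Prime).coprime_iff_not_dvd]
      intro hdvd
      rw [Nat.dvd_add_left (dvd_pow_self p (by lia))] at hdvd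
      exact (Fact.out : p.Prime).one_lt.ne' (Nat.dvd_one.mp hdvd)
    have hnJ : ∀ J : ℕ, ¬ p ∣ J → ‖((J * (1 + p ^ s) % p ^ A : ℕ) : ℚ_[p])‖ = 1 := fun J hJ =>
      norm_natCast_eq_one (not_dvd_mul_mod Fact.out hA hw hJ)
    -- With J' = J(1 + p^s) mod p^A, the new n' solves J'(n' + c_i) = J(n + c_i), so the image of
    -- ψ_i is unchanged, while the center for k is displaced by a multiple of (J' - J)(c_i - c_k).
    obtain ⟨τ, hτ⟩ := exists_orbitPerm (gammaMin C hC) hA hw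
      (fun J => (J : ℚ_[p]) / ((J * (1 + p ^ s) % p ^ A : ℕ) : ℚ_[p]))
      (fun J => (J : ℚ_[p]) / ((J * (1 + p ^ s) % p ^ A : ℕ) : ℚ_[p]) * center i - center i)
      (fun J hJ => by rw [norm_div, norm_natCast_eq_one hJ, hnJ J hJ, div_one])
    have hdiff : ∀ J : ℕ, ∃ q : ℕ, ((J * (1 + p ^ s) % p ^ A : ℕ) : ℚ_[p]) - J
        = J * (p : ℚ_[p]) ^ s - (p : ℚ_[p]) ^ A * q := by
      intro J
      refine ⟨J * (1 + p ^ s) / p ^ A, ?_⟩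
      have h1 := congrArg (Nat.cast : ℕ → ℚ_[p]) (Nat.div_add_mod (J * (1 + p ^ s)) (p ^ A))
      push_cast at h1 ⊢
      linear_combination h1
    have hnq : ∀ q : ℕ, ‖(p : ℚ_[p]) ^ A * q‖ ≤ (p : ℝ) ^ (-(A : ℤ)) := by
      intro q
      rw [norm_mul, ← zpow_natCast, norm_prime_zpow]
      exact mul_le_of_le_one_right (by positivity)
        (by simpa using Padic.norm_int_le_one (p := p) q)
    have hdle : ∀ J : ℕ, ¬ p ∣ J → ‖((J * (1 + p ^ s) % p ^ A : ℕ) : ℚ_[p]) - J‖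
        ≤ (p : ℝ) ^ (-(s : ℤ)) := by
      intro J hJ
      obtain ⟨q, hq⟩ := hdiff J
      rw [hq]
      refine norm_sub_le_of_le ?_ ((hnq q).trans (zpow_le_zpow_right₀ hp.le (by lia)))
      rw [norm_mul, norm_natCast_eq_one hJ, one_mul, ← zpow_natCast, norm_prime_zpow]
    have hdle' : ∀ J : ℕ, ¬ p ∣ J → ‖((J * (1 + p ^ s) % p ^ A : ℕ) : ℚ_[p]) - J‖
        ≤ (p : ℝ)⁻¹ := by
      intro J hJ
      refine (hdle J hJ).trans ?_
      rw [← zpow_neg_one]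
      exact zpow_le_zpow_right₀ hp.le (by lia)
    refine ⟨τ, 0, (p : ℚ_[p])⁻¹ * i.j * ((p : ℚ_[p]) ^ i.γ *
      ((p : ℚ_[p]) ^ s * (center i - center k))), ?_, ?_, ?_⟩
    · rw [zero_sub, norm_neg, norm_mul, norm_mul, norm_mul, norm_mul, norm_inv, Padic.norm_p,
        i.norm_j, hs, norm_prime_zpow, ← zpow_natCast, norm_prime_zpow, ← zpow_add₀ hp0.ne',
        ← zpow_add₀ hp0.ne', show -i.γ + (-(s : ℤ) + (i.γ + s)) = 0 by ring]
      simp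
    · intro t
      obtain ⟨e1, e2, e3⟩ := hτ t
      have hJ' := hnJ t.J t.not_dvd
      rw [e1, e2, e3, orbitWave_digitRep i _ _ hJ' (gammaMin_le hC hi)]
      set J' := ((t.J * (1 + p ^ s) % p ^ A : ℕ) : ℚ_[p]) with hJ'def
      have hJ0' : J' ≠ 0 := norm_ne_zero_iff.mp (by rw [hJ']; exact one_ne_zero)
      have e4 : t.J * (t.n + center i)
          - J' * (t.J / J' * t.n + (t.J / J' * center i - center i) + center i) = 0 := by
        field_simp
        ring
      rw [orbitWave_congr i t.γ (n := t.n) t.norm_J hJ' (hdle' t.J t.not_dvd)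
        (by rw [e4, mul_zero, norm_zero]; exact zero_le_one), e4, mul_zero, mul_zero]
    · intro t
      obtain ⟨e1, e2, e3⟩ := hτ t
      have hJ' := hnJ t.J t.not_dvd
      have hd := hdle t.J t.not_dvd
      have hd' := hdle' t.J t.not_dvd
      obtain ⟨q, hq⟩ := hdiff t.J
      rw [e1, e2, e3, orbitWave_digitRep k _ _ hJ' (gammaMin_le hC hk)]
      set J' := ((t.J * (1 + p ^ s) % p ^ A : ℕ) : ℚ_[p]) with hJ'def
      have hJ0' : J' ≠ 0 := norm_ne_zero_iff.mp (by rw [hJ']; exact one_ne_zero)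
      have hJ0 : (t.J : ℚ_[p]) ≠ 0 := norm_ne_zero_iff.mp (by rw [t.norm_J]; exact one_ne_zero)
      have e4 : t.J * (t.n + center k)
          - J' * (t.J / J' * t.n + (t.J / J' * center i - center i) + center k)
          = (J' - t.J) * (center i - center k) := by
        field_simp
        ring
      rw [orbitWave_congr k t.γ (n := t.n) t.norm_J hJ' hd' ?_, e4]
      · congr 1
        -- J cancels from the leading part J p^s of J' - J, leaving a phase independent of t. The
        -- carry p^A q contributes norm at most p^(1+s-A) ≤ 1, again because s + 1 ≤ A.
        refine χ_eq_of_norm_sub_le_one p ?_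
        have e5 : (p : ℚ_[p])⁻¹ * (k.j / t.J) * ((p : ℚ_[p]) ^ k.γ * ((J' - t.J)
            * (center i - center k))) - (p : ℚ_[p])⁻¹ * i.j * ((p : ℚ_[p]) ^ i.γ *
              ((p : ℚ_[p]) ^ s * (center i - center k)))
            = -((p : ℚ_[p])⁻¹ * i.j / t.J * ((p : ℚ_[p]) ^ i.γ * (((p : ℚ_[p]) ^ A * q)
              * (center i - center k)))) := by
          rw [hq, hγ, hj]
          field_simp
          ring
        rw [e5, norm_neg, norm_mul, norm_div, norm_mul, norm_mul, norm_mul _ (center i - center k),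
          i.norm_j, t.norm_J, hs, norm_inv, Padic.norm_p, inv_inv, norm_prime_zpow, mul_one,
          div_one]
        calc (p : ℝ) * ((p : ℝ) ^ (-i.γ) * (‖(p : ℚ_[p]) ^ A * q‖ * (p : ℝ) ^ (i.γ + s)))
            ≤ (p : ℝ) * ((p : ℝ) ^ (-i.γ) * ((p : ℝ) ^ (-(A : ℤ)) * (p : ℝ) ^ (i.γ + s))) := by
              gcongr
              exact hnq q
          _ = (p : ℝ) ^ (1 + (s : ℤ) - A) := by
              rw [← zpow_add₀ hp0.ne', ← zpow_add₀ hp0.ne', ← zpow_one_add₀ hp0.ne']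
              congr 1
              ring
          _ ≤ 1 := zpow_le_one_of_nonpos₀ hp.le (by lia)
      · rw [e4, norm_zpow_mul_le_one_iff, norm_mul, hs, ← hγ]
        calc ‖J' - t.J‖ * (p : ℝ) ^ (i.γ + s)
            ≤ (p : ℝ) ^ (-(s : ℤ)) * (p : ℝ) ^ (i.γ + s) := by gcongr
          _ = (p : ℝ) ^ i.γ := by
            rw [← zpow_add₀ hp0.ne']
            congr 1
            ring

/-! ### Diagonal terms: counting the orbit of one wavelet -/

theorem hasSum_comp_fst {α β : Type*} [Fintype β] {F : α → ℂ} {a : ℂ} (h : HasSum F a) :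
    HasSum (fun x : α × β => F x.1) (Fintype.card β * a) := by
  classical
  have h1 : ∀ b : β, HasSum (fun x : α × β => if x.2 = b then F x.1 else 0) a := by
    intro b
    refine (Function.Injective.hasSum_iff (g := fun y : α => (y, b))
      (fun _ _ h => congrArg Prod.fst h) ?_).mp (by simpa [Function.comp_def] using h)
    rintro ⟨y, b'⟩ hx
    refine if_neg fun hb => hx ⟨y, ?_⟩
    exact Prod.ext rfl (Eq.symm hb)
  simpa using hasSum_sum (s := Finset.univ) fun b _ => h1 b

theorem exists_mul_modEq {p : ℕ} [Fact p.Prime] {a b : ℕ} (ha : ¬ p ∣ a) (hb : ¬ p ∣ b) :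
    ∃ j, 1 ≤ j ∧ j < p ∧ a * j ≡ b [MOD p] := by
  have hp : p.Prime := Fact.out
  obtain ⟨c, -, hc⟩ := Nat.exists_mul_mod_eq_one_of_coprime
    ((hp.coprime_iff_not_dvd.mpr ha).symm) hp.one_lt
  have hmod : a * (c * b % p) ≡ b [MOD p] := by
    calc a * (c * b % p) ≡ a * (c * b) [MOD p] := (Nat.mod_modEq _ _).mul_left a
      _ = a * c * b := (mul_assoc _ _ _).symm
      _ ≡ 1 * b [MOD p] := Nat.ModEq.mul_right b (by rw [Nat.ModEq, hc, Nat.mod_eq_of_lt hp.one_lt])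
      _ = b := one_mul b
  refine ⟨c * b % p, Nat.one_le_iff_ne_zero.mpr fun h0 => hb ?_, Nat.mod_lt _ hp.pos, hmod⟩
  rw [h0, mul_zero] at hmod
  exact (Nat.modEq_zero_iff_dvd.mp hmod.symm)

theorem norm_natCast_sub_le_of_modEq {p : ℕ} [Fact p.Prime] {a b : ℕ} (h : a ≡ b [MOD p]) :
    ‖(a : ℚ_[p]) - b‖ ≤ (p : ℝ)⁻¹ := by
  have h1 : (p : ℤ) ^ 1 ∣ (a : ℤ) - b := by
    rw [pow_one]
    exact (Nat.modEq_iff_dvd.mp h.symm)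
  have h2 := (Padic.norm_int_le_pow_iff_dvd (p := p) _ 1).mpr (by exact_mod_cast h1)
  push_cast at h2
  simpa using h2

/-- The frequency `J₀` with `j_l J₀ ≡ j_i`. -/
theorem exists_freq {p : ℕ} [Fact p.Prime] (i l : WaveletIndex p) :
    ∃ J, 1 ≤ J ∧ J < p ∧ l.j * J ≡ i.j [MOD p] :=
  exists_mul_modEq (Nat.not_dvd_of_pos_of_lt l.j_pos l.j_lt)
    (Nat.not_dvd_of_pos_of_lt i.j_pos i.j_lt)

/-- The frequency in `1, …, p - 1` that carries the frequency of `i` to that of `l`. -/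
def freq {p : ℕ} [Fact p.Prime] (i l : WaveletIndex p) : ℕ := Classical.choose (exists_freq i l)

theorem freq_spec {p : ℕ} [Fact p.Prime] (i l : WaveletIndex p) :
    1 ≤ freq i l ∧ freq i l < p ∧ l.j * freq i l ≡ i.j [MOD p] :=
  Classical.choose_spec (exists_freq i l)

theorem not_dvd_freq_add {p : ℕ} [Fact p.Prime] (i l : WaveletIndex p) (q : ℕ) :
    ¬ p ∣ freq i l + p * q := by
  obtain ⟨h1, h2, -⟩ := freq_spec i l
  rw [Nat.dvd_add_left (dvd_mul_right p q)]
  exact Nat.not_dvd_of_pos_of_lt h1 h2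

/-- A translation parameter that carries the wavelet `i` to the wavelet `l`, up to a phase. -/
def shift {p : ℕ} [Fact p.Prime] (i l : WaveletIndex p) (J m : ℕ) : ℚ_[p] :=
  (p : ℚ_[p]) ^ (l.γ - i.γ) * (J : ℚ_[p])⁻¹ * center l - center i + m * (p : ℚ_[p]) ^ (-i.γ)

/-- The parameters of the orbit of the wavelet `i`, sorted by the wavelets `l` that they lead to. -/
def orbitParam {p : ℕ} [Fact p.Prime] (i : WaveletIndex p) (γ₀ : ℤ) {A : ℕ} (hA : 1 ≤ A) (D : ℕ)
    (x : WaveletIndex p × (Fin (p ^ (A - 1)) × Fin (p ^ D))) : OrbitIndex p γ₀ A where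
  γ := i.γ - x.1.γ
  n := digitRep p (1 - γ₀) (shift i x.1 (freq i x.1 + p * x.2.1) x.2.2)
  J := freq i x.1 + p * x.2.1
  n_mem := digitRep_mem _ _ _
  J_lt := by
    have h1 := (freq_spec i x.1).2.1
    have h2 : p * (x.2.1 + 1) ≤ p * p ^ (A - 1) := Nat.mul_le_mul_left p x.2.1.isLt
    rw [← pow_succ', Nat.sub_add_cancel hA] at h2
    lia
  not_dvd := not_dvd_freq_add _ _ _

theorem orbitWave_orbitParam {p : ℕ} [Fact p.Prime] (i : WaveletIndex p) {γ₀ : ℤ} (h : γ₀ ≤ i.γ)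
    {A : ℕ} (hA : 1 ≤ A) (D : ℕ) (x : WaveletIndex p × (Fin (p ^ (A - 1)) × Fin (p ^ D))) :
    ∃ y : ℚ_[p], orbitWave i (orbitParam i γ₀ hA D x).γ (orbitParam i γ₀ hA D x).n
      (orbitParam i γ₀ hA D x).J = χ p y • waveletVec p x.1 := by
  obtain ⟨l, q, m⟩ := x
  have hpp := prime_ne_zero p
  have hn := (orbitParam i γ₀ hA D (l, q, m)).norm_J
  have hmod := (freq_spec i l).2.2
  change ∃ y : ℚ_[p], orbitWave i (i.γ - l.γ) (digitRep p (1 - γ₀) (shift i l (freq i l + p * q) m))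
    ((freq i l + p * q : ℕ) : ℚ_[p]) = χ p y • waveVec p l.γ (center l) l.j
  change ‖((freq i l + p * q : ℕ) : ℚ_[p])‖ = 1 at hn
  have hmod2 : l.j * (freq i l + p * q) ≡ i.j [MOD p] := by
    refine Nat.ModEq.trans ?_ hmod
    rw [mul_add]
    exact (Nat.modEq_zero_iff_dvd.mpr ⟨l.j * q, by ring⟩ : l.j * (p * q) ≡ 0 [MOD p]).add_left _
  rw [orbitWave_digitRep i _ _ hn h]
  set J := freq i l + p * q with hJ
  have hJ0 : (J : ℚ_[p]) ≠ 0 := norm_ne_zero_iff.mp (by rw [hn]; exact one_ne_zero)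
  have e1 : (p : ℚ_[p]) ^ (i.γ - l.γ) * J * (shift i l J m + center i)
      = center l + J * m * (p : ℚ_[p]) ^ (-l.γ) := by
    rw [shift, zpow_sub₀ hpp, zpow_sub₀ hpp, zpow_neg, zpow_neg]
    field_simp
    ring
  rw [orbitWave, sub_sub_cancel, e1]
  refine ⟨_, waveVec_congr ?_ ?_⟩
  · rw [sub_add_cancel_left, mul_neg, norm_neg, mul_left_comm, ← zpow_add₀ hpp, add_neg_cancel,
      zpow_zero, mul_one, norm_mul, hn, one_mul]
    simpa using Padic.norm_int_le_one (p := p) (m : ℕ)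
  · have e2 : (i.j : ℚ_[p]) / J - l.j = (i.j - (l.j * J : ℕ)) / J := by
      push_cast
      field_simp
    rw [e2, norm_div, hn, div_one]
    exact norm_natCast_sub_le_of_modEq hmod2.symm

theorem orbitParam_bijective {p : ℕ} [Fact p.Prime] (i : WaveletIndex p) {γ₀ : ℤ} (h : γ₀ ≤ i.γ)
    {A : ℕ} (hA : 1 ≤ A) {D : ℕ} (hD : (D : ℤ) = i.γ + 1 - γ₀) :
    Function.Bijective (orbitParam i γ₀ hA D) := by
  have hp := one_lt_prime p
  have hp0 := prime_pos p
  have hpp := prime_ne_zero p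
  have hpr : p.Prime := Fact.out
  constructor
  · intro x x' hx
    -- The target wavelet is recovered from the orbit vector, since phase multiples of distinct
    -- wavelets are orthogonal.
    have hl : x.1 = x'.1 := by
      obtain ⟨y, hy⟩ := orbitWave_orbitParam i h hA D x
      obtain ⟨y', hy'⟩ := orbitWave_orbitParam i h hA D x'
      rw [← hx, hy] at hy'
      by_contra hne
      have h1 := congrArg (fun v : L2 p => (inner ℂ (waveletVec p x.1) v : ℂ)) hy'
      simp only [inner_smul_right, (orthonormal_waveletVec p).2 hne, mul_zero] at h1
      rw [inner_self_eq_norm_sq_to_K, (orthonormal_waveletVec p).1 x.1] at h1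
      simp [χ_ne_zero] at h1
    obtain ⟨l, q, m⟩ := x
    obtain ⟨l', q', m'⟩ := x'
    obtain rfl : l = l' := hl
    have hJ : freq i l + p * q = freq i l + p * q' := congrArg OrbitIndex.J hx
    have hq : q = q' := Fin.ext (Nat.eq_of_mul_eq_mul_left hpr.pos (Nat.add_left_cancel hJ))
    subst hq
    have hn : digitRep p (1 - γ₀) (shift i l (freq i l + p * q) m)
        = digitRep p (1 - γ₀) (shift i l (freq i l + p * q) m') := congrArg OrbitIndex.n hx
    have h1 := norm_sub_digitRep p (1 - γ₀) (shift i l (freq i l + p * q) m)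
    have h2 := norm_sub_digitRep p (1 - γ₀) (shift i l (freq i l + p * q) m')
    rw [← hn] at h2
    have h3 := norm_sub_le_of_le h1 h2
    rw [sub_sub_sub_cancel_right, shift, shift, add_sub_add_left_eq_sub, ← sub_mul, norm_mul,
      norm_prime_zpow, neg_neg, ← le_div_iff₀ (by positivity), ← zpow_sub₀ hp0.ne',
      show -(1 - γ₀) - i.γ = -(D : ℤ) by lia] at h3
    rw [Fin.ext (nat_eq_of_norm_sub_le m.isLt m'.isLt h3)]
  · intro t
    obtain ⟨j, hj1, hjp, hj⟩ := exists_mul_modEq (p := p) t.not_dvd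
      (Nat.not_dvd_of_pos_of_lt i.j_pos i.j_lt)
    -- The target is read off from t: its ball contains the transported center and its frequency j
    -- satisfies J j ≡ j_i modulo p. The higher digits of J then give q.
    set l := waveletAt p (i.γ - t.γ)
      ((p : ℚ_[p]) ^ t.γ * (t.J : ℚ_[p]) * (t.n + center i)) j hj1 hjp with hl
    have hlc := norm_center_waveletAt (i.γ - t.γ)
      ((p : ℚ_[p]) ^ t.γ * (t.J : ℚ_[p]) * (t.n + center i)) j hj1 hjp
    rw [← hl] at hlc
    have hlγ : l.γ = i.γ - t.γ := rfl
    have hfreq : freq i l = t.J % p := by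
      obtain ⟨-, h2, h3⟩ := freq_spec i l
      have h4 : j * freq i l ≡ j * t.J [MOD p] := h3.trans (by rw [mul_comm j]; exact hj.symm)
      have h5 := Nat.ModEq.cancel_left_of_coprime
        (hpr.coprime_iff_not_dvd.mpr (Nat.not_dvd_of_pos_of_lt hj1 hjp)) h4
      exact (Nat.mod_eq_of_lt h2).symm.trans h5
    have hJ : freq i l + p * (t.J / p) = t.J := by rw [hfreq, Nat.mod_add_div]
    have hq : t.J / p < p ^ (A - 1) := by
      refine Nat.div_lt_of_lt_mul ?_
      rw [← pow_succ', Nat.sub_add_cancel hA]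
      exact t.J_lt
    have hJ0 : (t.J : ℚ_[p]) ≠ 0 := norm_ne_zero_iff.mp (by rw [t.norm_J]; exact one_ne_zero)
    have hx : ‖t.n - shift i l t.J 0‖ ≤ (p : ℝ) ^ i.γ := by
      have e1 : t.n - shift i l t.J 0 = -((p : ℚ_[p]) ^ (-i.γ) * (t.J : ℚ_[p])⁻¹ *
          ((p : ℚ_[p]) ^ (i.γ - t.γ) *
            (center l - (p : ℚ_[p]) ^ t.γ * t.J * (t.n + center i)))) := by
        rw [shift, hlγ, show i.γ - t.γ - i.γ = -t.γ by ring, zpow_sub₀ hpp, zpow_neg, zpow_neg]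
        field_simp
        push_cast
        ring
      rw [e1, norm_neg, norm_mul, norm_mul, norm_inv, t.norm_J, inv_one, mul_one, norm_prime_zpow,
        neg_neg]
      exact mul_le_of_le_one_right (by positivity) hlc
    -- D digits suffice: starting from radius p^(γ_i) they reach precision p^(γ_i - D) = p^(γ₀ - 1),
    -- the radius of a class of n.
    obtain ⟨m, hm, hmle⟩ := exists_nat_norm_sub_le hx D
    refine ⟨(l, ⟨t.J / p, hq⟩, ⟨m, hm⟩), OrbitIndex.ext ?_ ?_ hJ⟩
    · change i.γ - l.γ = t.γ
      rw [hlγ]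
      ring
    · change digitRep p (1 - γ₀) (shift i l (freq i l + p * (t.J / p)) m) = t.n
      rw [hJ]
      refine digitRep_eq t.n_mem ?_
      rw [show i.γ - (D : ℤ) = -(1 - γ₀) by lia] at hmle
      have e2 : t.n - shift i l t.J 0 - m * (p : ℚ_[p]) ^ (-i.γ) = t.n - shift i l t.J m := by
        simp only [shift]
        push_cast
        ring
      rwa [e2, norm_sub_rev] at hmle

/-- The orbit of a single wavelet resolves a multiple of the identity. -/
theorem hasSum_orbitWave {p : ℕ} [Fact p.Prime] (i : WaveletIndex p) {γ₀ : ℤ} (h : γ₀ ≤ i.γ)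
    {A : ℕ} (hA : 1 ≤ A) (u v : L2 p) :
    HasSum (fun t : OrbitIndex p γ₀ A =>
        (inner ℂ u (orbitWave i t.γ t.n t.J) : ℂ) * inner ℂ (orbitWave i t.γ t.n t.J) v)
      ((((p : ℝ) ^ ((A : ℤ) - γ₀ + i.γ) : ℝ) : ℂ) * inner ℂ u v) := by
  obtain ⟨D, hD⟩ := Int.eq_ofNat_of_zero_le (show 0 ≤ i.γ + 1 - γ₀ by lia)
  have hD' : (D : ℤ) = i.γ + 1 - γ₀ := hD.symm
  let Φ := Equiv.ofBijective _ (orbitParam_bijective i h hA hD')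
  rw [← Φ.hasSum_iff]
  have hb := hasSum_comp_fst (β := Fin (p ^ (A - 1)) × Fin (p ^ D))
    ((waveletBasis p).hasSum_inner_mul_inner u v)
  rw [coe_waveletBasis] at hb
  have e1 : ((Fintype.card (Fin (p ^ (A - 1)) × Fin (p ^ D)) : ℕ) : ℂ)
      = (((p : ℝ) ^ ((A : ℤ) - γ₀ + i.γ) : ℝ) : ℂ) := by
    rw [Fintype.card_prod, Fintype.card_fin, Fintype.card_fin, ← pow_add,
      show (A : ℤ) - γ₀ + i.γ = ((A - 1 + D : ℕ) : ℤ) by push_cast [hA]; lia, zpow_natCast]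
    push_cast
    rfl
  rw [e1] at hb
  convert hb using 1
  funext x
  obtain ⟨y, hy⟩ := orbitWave_orbitParam i h hA D x
  change (inner ℂ u (orbitWave i (orbitParam i γ₀ hA D x).γ (orbitParam i γ₀ hA D x).n
    (orbitParam i γ₀ hA D x).J) : ℂ) * inner ℂ (orbitWave i (orbitParam i γ₀ hA D x).γ
      (orbitParam i γ₀ hA D x).n (orbitParam i γ₀ hA D x).J) v = _
  rw [hy, inner_smul_left, inner_smul_right, ← χ_neg]
  have : χ p y * χ p (-y) = 1 := by rw [← χ_add, add_neg_cancel, χ_zero]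
  linear_combination (inner ℂ u (waveletVec p x.1) * inner ℂ (waveletVec p x.1) v : ℂ) * this

/-! ### Mixed terms and the resolution of the identity -/

/-- The bound |ab| ≤ |a|² + |b|² reduces to two diagonal sums, with u in both slots and with v in
both slots. -/
theorem summable_orbitWave {p : ℕ} [Fact p.Prime] {i k : WaveletIndex p} {γ₀ : ℤ}
    (hi : γ₀ ≤ i.γ) (hk : γ₀ ≤ k.γ) {A : ℕ} (hA : 1 ≤ A) (u v : L2 p) :
    Summable fun t : OrbitIndex p γ₀ A =>
      (inner ℂ u (orbitWave i t.γ t.n t.J) : ℂ) * inner ℂ (orbitWave k t.γ t.n t.J) v := by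
  have h1 := (hasSum_orbitWave i hi hA u u).summable.norm
  have h2 := (hasSum_orbitWave k hk hA v v).summable.norm
  refine Summable.of_norm_bounded (h1.add h2) fun t => ?_
  rw [norm_mul, norm_mul, norm_mul, norm_inner_symm (𝕜 := ℂ) _ u,
    norm_inner_symm (𝕜 := ℂ) v]
  nlinarith [sq_nonneg (‖(inner ℂ u (orbitWave i t.γ t.n t.J) : ℂ)‖
    - ‖(inner ℂ (orbitWave k t.γ t.n t.J) v : ℂ)‖),
    norm_nonneg (inner ℂ u (orbitWave i t.γ t.n t.J) : ℂ),
    norm_nonneg (inner ℂ (orbitWave k t.γ t.n t.J) v : ℂ)]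

/-- The mixed terms of two different wavelets cancel. -/
theorem hasSum_orbitWave_of_ne {p : ℕ} [Fact p.Prime] {C : WaveletIndex p →₀ ℂ} (hC : C ≠ 0)
    {i k : WaveletIndex p} (hi : i ∈ C.support) (hk : k ∈ C.support) (hik : i ≠ k) (u v : L2 p) :
    HasSum (fun t : OrbitIndex p (gammaMin C hC) (gammaA C) =>
      (inner ℂ u (orbitWave i t.γ t.n t.J) : ℂ) * inner ℂ (orbitWave k t.γ t.n t.J) v) 0 := by
  have hs := (summable_orbitWave (gammaMin_le hC hi) (gammaMin_le hC hk) (one_le_gammaA C)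
    u v).hasSum
  obtain ⟨τ, x, y, hxy, h1, h2⟩ := exists_orbitPerm_phase hC hi hk hik
  have hs' := (τ.hasSum_iff).mpr hs
  have hs'' := hs.mul_left (χ p (x - y))
  have e1 : ((fun t : OrbitIndex p (gammaMin C hC) (gammaA C) =>
      (inner ℂ u (orbitWave i t.γ t.n t.J) : ℂ) * inner ℂ (orbitWave k t.γ t.n t.J) v) ∘ τ)
      = fun t => χ p (x - y) *
        ((inner ℂ u (orbitWave i t.γ t.n t.J) : ℂ) * inner ℂ (orbitWave k t.γ t.n t.J) v) := by
    funext t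
    simp only [Function.comp_apply]
    rw [h1, h2, inner_smul_right, inner_smul_left, ← χ_neg, sub_eq_add_neg, χ_add]
    ring
  rw [e1] at hs'
  have h3 := hs'.unique hs''
  have h4 : ∑' t : OrbitIndex p (gammaMin C hC) (gammaA C),
      (inner ℂ u (orbitWave i t.γ t.n t.J) : ℂ) * inner ℂ (orbitWave k t.γ t.n t.J) v = 0 := by
    by_contra hne
    exact χ_ne_one_of_norm_eq hxy (mul_right_cancel₀ hne (h3.symm.trans (one_mul _).symm))
  rwa [h4] at hs

end PadicFrame

end

open PadicFrame in
theorem mainTheorem2 (p : ℕ) [Fact p.Prime] (f : ℚ_[p] → ℂ) (hf : IsD0 p f)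
    (C : WaveletIndex p →₀ ℂ) (hC : C ≠ 0)
    (hfC : ∀ x : ℚ_[p], f x = ∑ i ∈ C.support, C i * wavelet p i x) :
    ∀ g h : L2 p,
      HasSum
        (fun t : OrbitIndex p (gammaMin C hC) (gammaA C) =>
          inner ℂ g (InnerProductSpace.rankOne ℂ (orbitVec hf t) (orbitVec hf t) h))
        (inner ℂ g
          ((((∑ i ∈ C.support,
              ‖C i‖ ^ 2 * (p : ℝ) ^ ((gammaA C : ℤ) - gammaMin C hC + i.γ) : ℝ) : ℂ) •
            ContinuousLinearMap.id ℂ (L2 p)) h)) := by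
  classical
  intro g h
  -- The expansion of f is finite, so the matrix element is a finite double sum over i and k, and
  -- each pair can be summed over the orbit separately.
  have key : ∀ i ∈ C.support, ∀ k ∈ C.support,
      HasSum (fun t : OrbitIndex p (gammaMin C hC) (gammaA C) =>
        C i * starRingEnd ℂ (C k) * ((inner ℂ g (orbitWave i t.γ t.n t.J) : ℂ)
          * inner ℂ (orbitWave k t.γ t.n t.J) h))
        (if i = k then ((‖C i‖ ^ 2 * (p : ℝ) ^ ((gammaA C : ℤ) - gammaMin C hC + i.γ) : ℝ) : ℂ)
          * inner ℂ g h else 0) := by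
    intro i hi k hk
    split_ifs with hik
    · subst hik
      have h1 := (hasSum_orbitWave i (gammaMin_le hC hi) (one_le_gammaA C) g h).mul_left
        (C i * starRingEnd ℂ (C i))
      have h2 : C i * starRingEnd ℂ (C i) = ((‖C i‖ ^ 2 : ℝ) : ℂ) := by
        rw [Complex.mul_conj, Complex.normSq_eq_norm_sq]
      rw [Complex.ofReal_mul, mul_assoc, ← h2]
      exact h1
    · simpa using (hasSum_orbitWave_of_ne hC hi hk hik g h).mul_left
        (C i * starRingEnd ℂ (C k))
  have total := hasSum_sum fun i hi => hasSum_sum fun k hk => key i hi k hk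
  convert total using 1
  · funext t
    rw [InnerProductSpace.rankOne_apply, inner_smul_right, orbitVec_eq_sum hf hfC, inner_sum,
      sum_inner, mul_comm, Finset.sum_mul]
    refine Finset.sum_congr rfl fun i _ => ?_
    rw [Finset.mul_sum]
    refine Finset.sum_congr rfl fun k _ => ?_
    rw [inner_smul_left, inner_smul_right]
    ring
  · rw [smul_apply, ContinuousLinearMap.id_apply, inner_smul_right,
      Complex.ofReal_sum, Finset.sum_mul]
    refine Finset.sum_congr rfl fun i hi => ?_
    rw [Finset.sum_ite_eq, if_pos hi]
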